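/- **Setting.** Let $D\subset\mathbb{R}^m$ and $E\subset\mathbb{R}^r$ be compact sets with Lipschitz boundaries (near each boundary point the set is, in suitable Cartesian coordinates, the region on or below the graph of a Lipschitz function). $C(\Omega;\mathbb{R}^d)$ carries the supremum norm, $C(\Omega)=C(\Omega;\mathbb{R})=C(\Omega;\mathbb{R}^1)$, and $D\times E\subset\mathbb{R}^{m+r}$. For $\rho\in C(D\times E)$ let $m_\rho(y)=\int_D\rho(x,y)\,dx$. For $\delta>0$ let $$\mathcal{X}_\delta=\Bigl\{\rho\in C(D\times E):\ \rho\ge 0,\ \int_{D\times E}\rho(z)\,dz=1,\ m_\rho(y)\ge\delta\ \text{ for all } y\in E\Bigr\},$$ and define the conditioning operators $$\mathcal{G}^\star:\mathcal{X}_\delta\to C(D\times E),\quad \mathcal{G}^\star(\rho)(x,y)=\frac{\rho(x,y)}{m_\rho(y)},\qquad \Psi^\star:\mathcal{X}_\delta\times E\to C(D),\quad \Psi^\star(\rho,y)(x)=\frac{\rho(x,y)}{m_\rho(y)}.$$ For $\alpha\in(0,1]$ let $\|f\|_{C^{0,\alpha}(D\times E)}=\max\bigl(\|f\|_{C(D\times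 E)},\ \sup_{z\ne z'}|f(z)-f(z')|/|z-z'|^{\alpha}\bigr)$, with $|\cdot|$ the Euclidean norm. **Architectures.** Fix an activation $\sigma:\mathbb{R}\to\mathbb{R}$ that is continuous and nonlinear (not of the form $t\mapsto at+b$); it acts on vectors coordinatewise. A *neural network* is a feedforward network with activation $\sigma$, of any depth (including affine maps) and any widths. Let $\Omega$ be a compact domain. * A *lifting* or *projection layer* is a map $f\mapsto\bigl(x\mapsto N(x,f(x))\bigr)$ with $N$ a neural network. * A *hidden layer* $C(\Omega;\mathbb{R}^{d})\to C(\Omega;\mathbb{R}^{d'})$ is a map $f\mapsto\sigma\bigl(Wf(x)+b+\sum_{k=1}^{M}\langle T_kf,\psi_k\rangle_{L^2(\Omega;\mathbb{R}^d)}\,\varphi_k(x)\bigr)$ with $W\in\mathbb{R}^{d'\times d}$, $b\in\mathbb{R}^{d'}$, $T_k:\mathbb{R}^d\to\mathbb{R}^d$ linear, $\psi_k\in C(\Omega;\mathbb{R}^d)$, $\varphi_k\in C(\Omega;\mathbb{R}^{d'})$. * A *neural operator* of depth $L>0$ is a composition $\mathcal{Q}\circ\mathcal{L}_L\circ\cdots\circ\mathcal{L}_1\circ\mathcal{R}$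 of a lifting layer $\mathcal R$, $L$ hidden layers $\mathcal{L}_\ell$ and a projection layer $\mathcal Q$. If the output functions live on a domain $\Omega'$ other than the input domain $\Omega$, the last hidden layer maps functions on $\Omega$ to functions on $\Omega'$: its $\varphi_k$ lie in $C(\Omega';\mathbb{R}^{d'})$ and the local term $Wf(x)$ is absent; the projection layer then acts on functions on $\Omega'$. * An *augmented neural operator* $\widetilde\Psi:C(D\times E)\times E\to C(D)$ is a map $\widetilde\Psi(\rho,y)=\Psi_0\bigl(\rho\oplus V(y)\bigr)$, where $V(y)(z)=h(z)\,\psi(y)$ with $h\in C(D\times E)$ and $\psi:\mathbb{R}^r\to\mathbb{R}^k$ a neural network, $(\rho\oplus V(y))(z)=(\rho(z),V(y)(z))$, and $\Psi_0$ is a neural operator from $C(D\times E;\mathbb{R}^{1+k})$ to $C(D)$. **Corollary (Approximation on Hölder compact sets).** Fix such $D$, $E$ and $\sigma$, and let $\alpha\in(0,1]$, $R>0$, $\delta>0$. Then the set $$\mathcal{S}=\mathcal{X}_\delta\cap\bigl\{f\in C(D\times E):\ \|f\|_{C^{0,\alpha}(D\times E)}\le R\bigr\}$$ is compact in $C(D\times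 E)$. Moreover, for every $\varepsilon>0$ there exist a neural operator $\Psi:C(D\times E)\to C(D\times E)$ and an augmented neural operator $\widetilde\Psi:C(D\times E)\times E\to C(D)$, both with activation $\sigma$, such that $$\sup_{\rho\in\mathcal{S}}\|\mathcal{G}^\star(\rho)-\Psi(\rho)\|_{C(D\times E)}\le\varepsilon\qquad\text{and}\qquad\sup_{(\rho,y)\in\mathcal{S}\times E}\|\Psi^\star(\rho,y)-\widetilde\Psi(\rho,y)\|_{C(D)}\le\varepsilon .$$ -/

import Mathlib

open MeasureTheory Topology TopologicalSpace
open scoped ENNReal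

noncomputable section

namespace CondNO

/-- Euclidean space `ℝⁿ`. -/
abbrev Vec (n : ℕ) : Type := EuclideanSpace ℝ (Fin n)

/-- Concatenation `(x, y) ∈ ℝᵃ⁺ᵇ` of `x ∈ ℝᵃ` and `y ∈ ℝᵇ`. -/
def vappend {a b : ℕ} (x : Vec a) (y : Vec b) : Vec (a + b) :=
  WithLp.toLp 2 (Fin.append x.ofLp y.ofLp)

/-- The last `b` coordinates of a vector in `ℝᵃ⁺ᵇ`. -/
def vlast {a b : ℕ} (z : Vec (a + b)) : Vec b :=
  WithLp.toLp 2 (fun j => z (Fin.natAdd a j))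

theorem continuous_vappend {a b : ℕ} :
    Continuous (fun q : Vec a × Vec b => vappend q.1 q.2) := by
  refine (PiLp.continuous_toLp 2 _).comp (continuous_pi fun i => ?_)
  refine Fin.addCases (fun i => ?_) (fun i => ?_) i
  · simp only [Fin.append_left]; fun_prop
  · simp only [Fin.append_right]; fun_prop

theorem continuous_vlast {a b : ℕ} : Continuous (vlast : Vec (a + b) → Vec b) := by
  unfold vlast; fun_prop

theorem vlast_vappend {a b : ℕ} (x : Vec a) (y : Vec b) : vlast (vappend x y) = y := by
  ext j; simp [vlast, vappend]

/-! ### Domains -/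

/-- `D` has a Lipschitz boundary: near each boundary point, `D` is, in a suitable orthonormal
frame whose last axis is `v`, the region on or below the graph of a Lipschitz function `γ` defined
on the hyperplane orthogonal to `v`. -/
def HasLipschitzBoundary {n : ℕ} (D : Set (Vec n)) : Prop :=
  ∀ p ∈ frontier D, ∃ v : Vec n, ‖v‖ = 1 ∧
    ∃ γ : ↥(Submodule.span ℝ {v})ᗮ → ℝ, (∃ K, LipschitzWith K γ) ∧
      ∀ᶠ x in 𝓝 p,
        (x ∈ D ↔ inner ℝ v x ≤ γ ((Submodule.span ℝ {v})ᗮ.orthogonalProjectionOnto x))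

/-- The compact set `D × E`, as a subset of `ℝᵐ⁺ʳ`. -/
def prodDom {m r : ℕ} (D : Compacts (Vec m)) (E : Compacts (Vec r)) : Compacts (Vec (m + r)) :=
  (D ×ˢ E).map (fun q => vappend q.1 q.2) continuous_vappend

/-- The point `(x, y)` of `D × E`. -/
def mkPt {m r : ℕ} {D : Compacts (Vec m)} {E : Compacts (Vec r)} (x : D) (y : E) :
    prodDom D E :=
  ⟨vappend x.1 y.1, ⟨(x.1, y.1), ⟨x.2, y.2⟩, rfl⟩⟩

/-- The component `y` of a point `(x, y)` of `D × E`. -/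
def sndPt {m r : ℕ} {D : Compacts (Vec m)} {E : Compacts (Vec r)} (z : prodDom D E) : E :=
  ⟨vlast z.1, by
    obtain ⟨z, ⟨⟨x, y⟩, ⟨_, hy⟩, rfl⟩⟩ := z
    simpa [vlast_vappend] using hy⟩

theorem continuous_mkPt {m r : ℕ} {D : Compacts (Vec m)} {E : Compacts (Vec r)} :
    Continuous (fun q : D × E => mkPt q.1 q.2) :=
  Continuous.subtype_mk (continuous_vappend.comp
    ((continuous_subtype_val.comp continuous_fst).prodMk
      (continuous_subtype_val.comp continuous_snd))) _

theorem continuous_sndPt {m r : ℕ} {D : Compacts (Vec m)} {E : Compacts (Vec r)} :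
    Continuous (sndPt : prodDom D E → E) :=
  Continuous.subtype_mk (continuous_vlast.comp continuous_subtype_val) _

/-- Lebesgue measure on a compact set `B ⊆ ℝᵏ`. -/
def leb {k : ℕ} (B : Compacts (Vec k)) : Measure B :=
  Measure.comap (Subtype.val : B → Vec k) volume

/-! ### Densities and conditioning operators -/

/-- `C_ac(B)`: the continuous Lebesgue probability densities on the compact set `B`. -/
def densities {k : ℕ} (B : Compacts (Vec k)) : Set C(B, ℝ) :=
  {ρ | ∫ z, ρ z ∂(leb B) = 1 ∧ ∀ z, 0 ≤ ρ z}

/-- The marginal `m_ρ(y) = ∫_D ρ(x, y) dx`. -/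
def marginal {m r : ℕ} {D : Compacts (Vec m)} {E : Compacts (Vec r)}
    (ρ : C(prodDom D E, ℝ)) (y : E) : ℝ :=
  ∫ x, ρ (mkPt x y) ∂(leb D)

/-- `𝒳_δ`: the densities on `D × E` whose marginal is at least `δ` everywhere on `E`. -/
def densitiesGE {m r : ℕ} (D : Compacts (Vec m)) (E : Compacts (Vec r)) (δ : ℝ) :
    Set C(prodDom D E, ℝ) :=
  {ρ | ρ ∈ densities (prodDom D E) ∧ ∀ y : E, δ ≤ marginal ρ y}

theorem continuous_marginal {m r : ℕ} {D : Compacts (Vec m)} {E : Compacts (Vec r)}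
    (ρ : C(prodDom D E, ℝ)) : Continuous (marginal ρ) := by
  have hfin : IsFiniteMeasure (leb D) := by
    refine ⟨?_⟩
    have he : MeasurableEmbedding (Subtype.val : D → Vec m) :=
      MeasurableEmbedding.subtype_coe D.isCompact.isClosed.measurableSet
    rw [leb, he.comap_apply]
    exact (measure_mono (by rintro _ ⟨x, _, rfl⟩; exact x.2)).trans_lt
      D.isCompact.measure_lt_top
  unfold marginal
  refine continuous_of_dominated (bound := fun _ => ‖ρ‖) (fun y => ?_) (fun y => ?_)
    (integrable_const _) ?_
  · exact (ρ.continuous.comp (continuous_mkPt.comp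
      (continuous_id.prodMk continuous_const))).aestronglyMeasurable
  · exact Filter.Eventually.of_forall fun x => ρ.norm_coe_le_norm _
  · exact Filter.Eventually.of_forall fun x => ρ.continuous.comp (continuous_mkPt.comp
      (continuous_const.prodMk continuous_id))

/-- The kernel conditioning operator `𝒢⋆ : 𝒳_δ → C(D × E)`,
`𝒢⋆(ρ)(x, y) = ρ(x, y) / m_ρ(y)`. -/
def kernelOp {m r : ℕ} {D : Compacts (Vec m)} {E : Compacts (Vec r)} {δ : ℝ} (hδ : 0 < δ)
    (ρ : densitiesGE D E δ) : C(prodDom D E, ℝ) where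
  toFun z := ρ.1 z / marginal ρ.1 (sndPt z)
  continuous_toFun := ρ.1.continuous.div ((continuous_marginal ρ.1).comp continuous_sndPt)
    fun z => (hδ.trans_le (ρ.2.2 (sndPt z))).ne'

/-- The in-context conditioning operator `Ψ⋆ : 𝒳_δ × E → C(D)`,
`Ψ⋆(ρ, y)(x) = ρ(x, y) / m_ρ(y)`. -/
def incontextOp {m r : ℕ} {D : Compacts (Vec m)} {E : Compacts (Vec r)} {δ : ℝ}
    (q : densitiesGE D E δ × E) : C(D, ℝ) where
  toFun x := q.1.1 (mkPt x q.2) / marginal q.1.1 q.2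
  continuous_toFun := (q.1.1.continuous.comp (continuous_mkPt.comp
    (continuous_id.prodMk continuous_const))).div_const _

/-! ### Hölder balls -/

/-- The Hölder norm `max (‖f‖_{C(B)}, sup_{z ≠ z'} |f z - f z'| / |z - z'|^α)`, with values in
`[0, ∞]`; it is finite exactly on `C^{0,α}(B)`. -/
def holderENorm {k : ℕ} {B : Compacts (Vec k)} (α : ℝ) (f : C(B, ℝ)) : ℝ≥0∞ :=
  max ‖f‖ₑ (⨆ (z : B) (z' : B) (_ : z ≠ z'), ‖f z - f z'‖ₑ / edist z z' ^ α)

/-- `ℋ^α_R`: the ball of radius `R` in `C^{0,α}(B)`. -/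
def holderBall {k : ℕ} (B : Compacts (Vec k)) (α R : ℝ) : Set C(B, ℝ) :=
  {f | holderENorm α f ≤ ENNReal.ofReal R}

/-! ### Neural networks and neural operators -/

/-- The activation `σ` applied to each coordinate. -/
def act (σ : ℝ → ℝ) {n : ℕ} (x : Vec n) : Vec n := WithLp.toLp 2 (fun i => σ (x i))

/-- Feedforward neural networks with activation `σ`, any number (possibly zero) of hidden layers
and any widths. -/
inductive IsNeuralNetwork (σ : ℝ → ℝ) : {a b : ℕ} → (Vec a → Vec b) → Prop
  | affine {a b : ℕ} (A : Vec a →ₗ[ℝ] Vec b) (c : Vec b) :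
      IsNeuralNetwork σ (fun x => A x + c)
  | layer {a b c : ℕ} (A : Vec a →ₗ[ℝ] Vec b) (w : Vec b) (g : Vec b → Vec c) :
      IsNeuralNetwork σ g → IsNeuralNetwork σ (fun x => g (act σ (A x + w)))

/-- Maps `f ↦ (x ↦ N(x, f(x)))` with `N` a neural network: lifting layers and projection
layers are both of this form. -/
def IsPointwiseLayer (σ : ℝ → ℝ) {p d d' : ℕ} {Ω : Compacts (Vec p)}
    (F : C(Ω, Vec d) → C(Ω, Vec d')) : Prop :=
  ∃ N : Vec (p + d) → Vec d', IsNeuralNetwork σ N ∧ ∀ f x, F f x = N (vappend x.1 (f x))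

/-- The `L²` pairing `∫_Ω ⟨f(x), g(x)⟩ dx`. -/
def pairing {p d : ℕ} {Ω : Compacts (Vec p)} (f g : Ω → Vec d) : ℝ :=
  ∫ x, inner ℝ (f x) (g x) ∂(leb Ω)

/-- Hidden layers `f ↦ σ(W f(x) + b + ∑ₖ ⟨Tₖ f, ψₖ⟩ φₖ(x))`. -/
def IsHiddenLayer (σ : ℝ → ℝ) {p d d' : ℕ} {Ω : Compacts (Vec p)}
    (F : C(Ω, Vec d) → C(Ω, Vec d')) : Prop :=
  ∃ (W : Vec d →ₗ[ℝ] Vec d') (b : Vec d') (M : ℕ) (T : Fin M → Vec d →ₗ[ℝ] Vec d)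
    (ψ : Fin M → C(Ω, Vec d)) (φ : Fin M → C(Ω, Vec d')),
    ∀ f x, F f x =
      act σ (W (f x) + b + ∑ k, pairing (fun u => T k (f u)) (ψ k) • φ k x)

/-- Hidden layers `f ↦ σ(b + ∑ₖ ⟨Tₖ f, ψₖ⟩ φₖ(x))` from functions on `Ω` to functions on another
domain `Ω'`: the decoding functions `φₖ` live on `Ω'`, and there is no local term `W f(x)`, since
`f(x)` is meaningless for `x ∈ Ω'`. -/
def IsTransferLayer (σ : ℝ → ℝ) {p p' d d' : ℕ} {Ω : Compacts (Vec p)} {Ω' : Compacts (Vec p')}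
    (F : C(Ω, Vec d) → C(Ω', Vec d')) : Prop :=
  ∃ (b : Vec d') (M : ℕ) (T : Fin M → Vec d →ₗ[ℝ] Vec d)
    (ψ : Fin M → C(Ω, Vec d)) (φ : Fin M → C(Ω', Vec d')),
    ∀ f x, F f x = act σ (b + ∑ k, pairing (fun u => T k (f u)) (ψ k) • φ k x)

/-- Compositions of `L` hidden layers on the domain `Ω`. -/
inductive IsHiddenStack (σ : ℝ → ℝ) {p : ℕ} {Ω : Compacts (Vec p)} :
    (L : ℕ) → {d d' : ℕ} → (C(Ω, Vec d) → C(Ω, Vec d')) → Prop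
  | nil {d : ℕ} : IsHiddenStack σ 0 (id : C(Ω, Vec d) → C(Ω, Vec d))
  | snoc {L d d' d'' : ℕ} (F : C(Ω, Vec d) → C(Ω, Vec d')) (G : C(Ω, Vec d') → C(Ω, Vec d'')) :
      IsHiddenStack σ L F → IsHiddenLayer σ G → IsHiddenStack σ (L + 1) (G ∘ F)

/-- Neural operators of depth `L > 0` with activation `σ` whose input and output functions live
on the same domain: `Ψ = 𝒬 ∘ ℒ_L ∘ ⋯ ∘ ℒ_1 ∘ ℛ`. -/
def IsNeuralOperator (σ : ℝ → ℝ) (L : ℕ) {p d d' : ℕ} {Ω : Compacts (Vec p)}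
    (Ψ : C(Ω, Vec d) → C(Ω, Vec d')) : Prop :=
  0 < L ∧ ∃ (d₀ dL : ℕ) (R : C(Ω, Vec d) → C(Ω, Vec d₀)) (H : C(Ω, Vec d₀) → C(Ω, Vec dL))
    (Q : C(Ω, Vec dL) → C(Ω, Vec d')),
    IsPointwiseLayer σ R ∧ IsHiddenStack σ L H ∧ IsPointwiseLayer σ Q ∧ Ψ = Q ∘ H ∘ R

/-- Neural operators of depth `L > 0` with activation `σ` from functions on `Ω` to functions on
another domain `Ω'`: the first `L - 1` hidden layers act on `Ω`, and the last one passes from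
`Ω` to `Ω'`. -/
def IsNeuralOperatorBetween (σ : ℝ → ℝ) (L : ℕ) {p p' d d' : ℕ} {Ω : Compacts (Vec p)}
    {Ω' : Compacts (Vec p')} (Ψ : C(Ω, Vec d) → C(Ω', Vec d')) : Prop :=
  0 < L ∧ ∃ (d₀ d₁ dL : ℕ) (R : C(Ω, Vec d) → C(Ω, Vec d₀)) (H : C(Ω, Vec d₀) → C(Ω, Vec d₁))
    (T : C(Ω, Vec d₁) → C(Ω', Vec dL)) (Q : C(Ω', Vec dL) → C(Ω', Vec d')),
    IsPointwiseLayer σ R ∧ IsHiddenStack σ (L - 1) H ∧ IsTransferLayer σ T ∧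
      IsPointwiseLayer σ Q ∧ Ψ = Q ∘ T ∘ H ∘ R

/-- The function `x ↦ h(x) v`; with `v = ψ(z)` this is the vector-to-function layer
`V(z)(x) = h(x) ψ(z)`. -/
def vecToFun {p k : ℕ} {Ω : Compacts (Vec p)} (h : C(Ω, ℝ)) (v : Vec k) : C(Ω, Vec k) where
  toFun x := h x • v
  continuous_toFun := h.continuous.smul continuous_const

/-- Concatenation of functions, `(f ⊕ g)(x) = (f(x), g(x))`. -/
def concat {p a b : ℕ} {Ω : Compacts (Vec p)} (f : C(Ω, Vec a)) (g : C(Ω, Vec b)) :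
    C(Ω, Vec (a + b)) where
  toFun x := vappend (f x) (g x)
  continuous_toFun := continuous_vappend.comp (f.continuous.prodMk g.continuous)

/-- Augmented neural operators of depth `L > 0`: maps `(f, z) ↦ Ψ(f ⊕ V(z))` with `Ψ` a neural
operator and `V(z)(x) = h(x) ψ(z)` a vector-to-function layer. -/
def IsAugNeuralOperator (σ : ℝ → ℝ) (L : ℕ) {p p' n d d' : ℕ} {Ω : Compacts (Vec p)}
    {Ω' : Compacts (Vec p')} {Z : Compacts (Vec n)}
    (Ψt : C(Ω, Vec d) × Z → C(Ω', Vec d')) : Prop :=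
  ∃ (k : ℕ) (h : C(Ω, ℝ)) (ψ : Vec n → Vec k) (Ψ : C(Ω, Vec (d + k)) → C(Ω', Vec d')),
    IsNeuralNetwork σ ψ ∧ IsNeuralOperatorBetween σ L Ψ ∧
      ∀ f z, Ψt (f, z) = Ψ (concat f (vecToFun h (ψ z.1)))

/-- The identification of `C(Ω)` with `C(Ω; ℝ¹)`. -/
def toVec {p : ℕ} {Ω : Compacts (Vec p)} (f : C(Ω, ℝ)) : C(Ω, Vec 1) where
  toFun x := WithLp.toLp 2 (fun _ => f x)
  continuous_toFun := by fun_prop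

/-- Neural operators `C(Ω) → C(Ω)`. -/
def IsScalarNeuralOperator (σ : ℝ → ℝ) (L : ℕ) {p : ℕ} {Ω : Compacts (Vec p)}
    (Ψ : C(Ω, ℝ) → C(Ω, ℝ)) : Prop :=
  ∃ Φ : C(Ω, Vec 1) → C(Ω, Vec 1), IsNeuralOperator σ L Φ ∧ ∀ f, toVec (Ψ f) = Φ (toVec f)

/-- Augmented neural operators `C(Ω) × Z → C(Ω')`. -/
def IsScalarAugNeuralOperator (σ : ℝ → ℝ) (L : ℕ) {p p' n : ℕ} {Ω : Compacts (Vec p)}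
    {Ω' : Compacts (Vec p')} {Z : Compacts (Vec n)}
    (Ψt : C(Ω, ℝ) × Z → C(Ω', ℝ)) : Prop :=
  ∃ Φ : C(Ω, Vec 1) × Z → C(Ω', Vec 1), IsAugNeuralOperator σ L Φ ∧
    ∀ f z, toVec (Ψt (f, z)) = Φ (toVec f, z)

end CondNO

end

namespace CondNO

/-! ### Closures in the compact-open topology -/

/-! Compactness is Arzelà–Ascoli: the members of a Hölder ball share a bound and a modulus of
continuity, and the Hölder bounds and the constraints defining `𝒳_δ` survive uniform limits.

Both operators compute a quotient `u / v` with `u = ρ(x, y)` and `v = m_ρ(y) ≥ δ`. Division is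
continuous in this range, so a network on `ℝ²` performs it up to a small error, even when its inputs
are slightly wrong (`exists_isLayered_div`). It remains to produce `u` and `v` by finite-rank
integrals, the only nonlocal operation of a hidden layer. A partition of unity `φ_l` on a fine scale
gives the kernel `κ(y, y') = ∑ φ_l(y) φ_l(y') / ∫ φ_l` (`exists_averagingKernel`); Lipschitz
boundaries serve only to make `∫ φ_l` positive. By the common modulus of continuity, integrating `ρ`
against `κ(y, y')` gives `m_ρ(y)` up to a uniformly small error.

For `𝒢⋆` the value `u` is carried by the local term. For `Ψ⋆` there is no local term across domains,
but `y` is an input: the lifting network approximates `ρ(x', y') κ'(y, y')`, whose integrals against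
a kernel `κ(x, x')` and against `1` approximate `u` and `v`.

Universality of networks for a continuous non-affine `σ` (`exists_isLayered_near`) has to use depth,
since `σ` may be a polynomial. The square function is a limit of shallow networks
(`sq_mem_ridgeSpan`), polarization gives products, composition gives all polynomials, and
Stone–Weierstrass concludes. -/

theorem mem_closure_iff_forall_isCompact {X β : Type*} [TopologicalSpace X] [PseudoMetricSpace β]
    {S : Set C(X, β)} {f : C(X, β)} :
    f ∈ closure S ↔ ∀ K : Set X, IsCompact K → ∀ ε > 0, ∃ g ∈ S, ∀ x ∈ K, dist (f x) (g x) < ε := by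
  rw [mem_closure_iff_nhds_basis'
    (nhds_basis_uniformity' (Metric.uniformity_basis_dist (α := β)).compactConvergenceUniformity)]
  constructor
  · intro h K hK ε hε
    obtain ⟨g, hg, hgS⟩ := h (K, ε) ⟨hK, hε⟩
    exact ⟨g, hgS, hg⟩
  · rintro h ⟨K, ε⟩ ⟨hK, hε⟩
    obtain ⟨g, hgS, hg⟩ := h K hK ε hε
    exact ⟨g, hg, hgS⟩

/-- A closed subspace of `C(ℝ, ℝ)` contains the averages of its continuous curves. -/
theorem average_mem_of_isClosed {V : Submodule ℝ C(ℝ, ℝ)} (hV : IsClosed (V : Set C(ℝ, ℝ)))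
    (Φ : ℝ → C(ℝ, ℝ)) (hΦ : Continuous Φ) (hΦV : ∀ s, Φ s ∈ V) (g : C(ℝ, ℝ))
    (hg : ∀ t, g t = ∫ s in (0 : ℝ)..1, Φ s t) : g ∈ V := by
  rw [← SetLike.mem_coe, ← hV.closure_eq, mem_closure_iff_forall_isCompact]
  intro K hK ε hε
  have : CompactSpace K := isCompact_iff_compactSpace.1 hK
  -- Restriction to `K` lands in a Banach space, where the average is a Bochner integral and
  -- therefore stays in the closed convex set spanned by the curve.
  let res : C(ℝ, ℝ) →ₗ[ℝ] C(K, ℝ) :=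
    { toFun := fun f => f.restrict K
      map_add' := fun _ _ => rfl
      map_smul' := fun _ _ => rfl }
  have hres : Continuous res := ContinuousMap.continuous_restrict K
  have hcont : Continuous fun s => res (Φ s) := hres.comp hΦ
  have hprob : IsProbabilityMeasure (volume.restrict (Set.Ioc (0 : ℝ) 1)) :=
    ⟨by simp⟩
  have hint : Integrable (fun s => res (Φ s)) (volume.restrict (Set.Ioc (0 : ℝ) 1)) :=
    (hcont.integrableOn_Icc (a := 0) (b := 1)).mono_set Set.Ioc_subset_Icc_self
  have hmem : ∫ s, res (Φ s) ∂(volume.restrict (Set.Ioc (0 : ℝ) 1)) ∈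
      closure ((V.map res : Submodule ℝ C(K, ℝ)) : Set C(K, ℝ)) :=
    ((V.map res).convex.closure).integral_mem isClosed_closure
      (Filter.Eventually.of_forall fun s =>
        subset_closure (Submodule.mem_map_of_mem (hΦV s))) hint
  obtain ⟨_, ⟨f, hf, rfl⟩, hlt⟩ := Metric.mem_closure_iff.1 hmem ε hε
  refine ⟨f, hf, fun x hx => ?_⟩
  refine lt_of_le_of_lt (le_of_eq_of_le ?_ (ContinuousMap.dist_apply_le_dist (⟨x, hx⟩ : K))) hlt
  rw [ContinuousMap.integral_apply hint, hg, intervalIntegral.integral_of_le zero_le_one]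
  rfl

/-! ### The square function is a limit of shallow networks -/

/-- `σ(t + 2u) - 2σ(t + u) + σ(t)`. -/
def secondDiff (σ : ℝ → ℝ) (u t : ℝ) : ℝ := σ (t + 2 * u) - 2 * σ (t + u) + σ t

/-- If all second differences vanish, `σ` is midpoint affine, so `σ - σ 0` is additive; being
continuous, it is linear. -/
theorem exists_secondDiff_ne_zero {σ : ℝ → ℝ} (hσ : Continuous σ)
    (hσ' : ¬ ∃ a b : ℝ, ∀ t, σ t = a * t + b) : ∃ u t, secondDiff σ u t ≠ 0 := by
  by_contra! h
  have hmid : ∀ x y, σ x + σ y = 2 * σ ((x + y) / 2) := fun x y => by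
    have := h ((y - x) / 2) x
    simp only [secondDiff] at this
    rw [show x + 2 * ((y - x) / 2) = y by ring, show x + (y - x) / 2 = (x + y) / 2 by ring] at this
    linarith
  let f : ℝ →+ ℝ := AddMonoidHom.mk' (fun t => σ t - σ 0) fun x y => by
    have h1 := hmid x y
    have h2 := hmid (x + y) 0
    rw [add_zero] at h2
    linarith
  have hf : Continuous f := hσ.sub continuous_const
  refine hσ' ⟨σ 1 - σ 0, σ 0, fun t => ?_⟩
  have := (f.toRealLinearMap hf).map_smul t 1
  simp only [smul_eq_mul, mul_one] at this
  have h3 : σ t - σ 0 = t * (σ 1 - σ 0) := this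
  linarith

/-- Let `G'' = σ`. Averaging twice over steps of length `v`, times `v ^ 2`, is the second difference
of step `v` of `G`. Both sides are thus the iterated second difference of `G` with steps `u` and
`v`, and differences commute. No smoothness of `σ` is needed. -/
theorem integral_integral_secondDiff {σ : ℝ → ℝ} (hσ : Continuous σ) (u v t : ℝ) :
    v ^ 2 * ∫ s in (0 : ℝ)..1, ∫ s' in (0 : ℝ)..1, secondDiff σ u (t + v * s + v * s') =
    u ^ 2 * ∫ s in (0 : ℝ)..1, ∫ s' in (0 : ℝ)..1, secondDiff σ v (t + u * s + u * s') := by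
  let S : ℝ → ℝ := fun x => ∫ y in (0 : ℝ)..x, σ y
  have hi : ∀ a b, IntervalIntegrable σ volume a b := fun a b => hσ.intervalIntegrable a b
  have hS : Continuous S := intervalIntegral.continuous_primitive hi 0
  let G : ℝ → ℝ := fun x => ∫ y in (0 : ℝ)..x, S y
  have hSi : ∀ a b, IntervalIntegrable S volume a b := fun a b => hS.intervalIntegrable a b
  have h1 : ∀ w c, w * ∫ s in (0 : ℝ)..1, σ (c + w * s) = S (c + w) - S c := fun w c => by
    rw [intervalIntegral.mul_integral_comp_add_mul,
      intervalIntegral.integral_interval_sub_left (hi _ _) (hi _ _)]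
    simp
  have h2 : ∀ w c, w * ∫ s in (0 : ℝ)..1, S (c + w * s) = G (c + w) - G c := fun w c => by
    rw [intervalIntegral.mul_integral_comp_add_mul,
      intervalIntegral.integral_interval_sub_left (hSi _ _) (hSi _ _)]
    simp
  have key : ∀ w z, w ^ 2 * ∫ s in (0 : ℝ)..1, ∫ s' in (0 : ℝ)..1,
      secondDiff σ z (t + w * s + w * s') = secondDiff (secondDiff G w) z t := fun w z => by
    have e1 : ∀ s, w * ∫ s' in (0 : ℝ)..1, secondDiff σ z (t + w * s + w * s') =
        secondDiff S z (t + w + w * s) - secondDiff S z (t + w * s) := fun s => by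
      have hc : ∀ c : ℝ, IntervalIntegrable (fun s' => σ (c + w * s')) volume 0 1 :=
        fun c => (by fun_prop : Continuous fun s' => σ (c + w * s')).intervalIntegrable _ _
      have e : ∀ s', secondDiff σ z (t + w * s + w * s') = σ (t + w * s + 2 * z + w * s') -
          2 * σ (t + w * s + z + w * s') + σ (t + w * s + w * s') := fun s' => by
        unfold secondDiff; congr 3 <;> ring_nf
      simp_rw [e]
      rw [intervalIntegral.integral_add ((hc _).sub ((hc _).const_mul _)) (hc _),
        intervalIntegral.integral_sub (hc _) ((hc _).const_mul _),
        intervalIntegral.integral_const_mul]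
      have a1 := h1 w (t + w * s + 2 * z)
      have a2 := h1 w (t + w * s + z)
      have a3 := h1 w (t + w * s)
      unfold secondDiff
      rw [show t + w + w * s + 2 * z = t + w * s + 2 * z + w by ring,
        show t + w + w * s + z = t + w * s + z + w by ring,
        show t + w + w * s = t + w * s + w by ring]
      linear_combination a1 - 2 * a2 + a3
    have hcS : ∀ c : ℝ, IntervalIntegrable (fun s' => S (c + w * s')) volume 0 1 :=
      fun c => (by fun_prop : Continuous fun s' => S (c + w * s')).intervalIntegrable _ _
    have e2 : ∀ c, w * ∫ s in (0 : ℝ)..1, secondDiff S z (c + w * s) =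
        secondDiff G z (c + w) - secondDiff G z c := fun c => by
      have e : ∀ s', secondDiff S z (c + w * s') = S (c + 2 * z + w * s') -
          2 * S (c + z + w * s') + S (c + w * s') := fun s' => by
        unfold secondDiff; congr 3 <;> ring_nf
      simp_rw [e]
      rw [intervalIntegral.integral_add ((hcS _).sub ((hcS _).const_mul _)) (hcS _),
        intervalIntegral.integral_sub (hcS _) ((hcS _).const_mul _),
        intervalIntegral.integral_const_mul]
      have a1 := h2 w (c + 2 * z)
      have a2 := h2 w (c + z)
      have a3 := h2 w c
      unfold secondDiff
      rw [show c + w + 2 * z = c + 2 * z + w by ring, show c + w + z = c + z + w by ring]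
      linear_combination a1 - 2 * a2 + a3
    have hcd : ∀ c : ℝ, IntervalIntegrable (fun s => secondDiff S z (c + w * s)) volume 0 1 :=
      fun c => (by unfold secondDiff; fun_prop :
        Continuous fun s => secondDiff S z (c + w * s)).intervalIntegrable _ _
    rw [pow_two, mul_assoc, ← intervalIntegral.integral_const_mul]
    simp_rw [e1]
    rw [intervalIntegral.integral_sub (hcd _) (hcd _), mul_sub, e2, e2]
    unfold secondDiff
    rw [show t + w + w = t + 2 * w by ring]
    ring_nf
  rw [key v u, key u v]
  unfold secondDiff
  ring_nf

/-- The ridge functions `t ↦ σ(wt + b)`. -/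
def ridge (σ : C(ℝ, ℝ)) (w b : ℝ) : C(ℝ, ℝ) := ⟨fun t => σ (w * t + b), by fun_prop⟩

/-- The closed span of the ridge functions. -/
def ridgeSpan (σ : C(ℝ, ℝ)) : Submodule ℝ C(ℝ, ℝ) :=
  (Submodule.span ℝ (Set.range fun p : ℝ × ℝ => ridge σ p.1 p.2)).topologicalClosure

theorem ridge_mem_ridgeSpan (σ : C(ℝ, ℝ)) (w b : ℝ) : ridge σ w b ∈ ridgeSpan σ :=
  Submodule.le_topologicalClosure _ (Submodule.subset_span ⟨(w, b), rfl⟩)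

theorem isClosed_ridgeSpan (σ : C(ℝ, ℝ)) : IsClosed (ridgeSpan σ : Set C(ℝ, ℝ)) :=
  Submodule.isClosed_topologicalClosure _

/-- For fixed `c`, the second difference of `σ` at `c` with step `h * t` is, as a function of `t`, a
combination of ridge functions. Its average over `c = t₀ + u * s + u * s'` stays in the closed span
and, by `integral_integral_secondDiff`, equals `h ^ 2 / u ^ 2` times `t ^ 2` times an average of
`secondDiff σ u` near `t₀` when `u ≠ 0`. As `h → 0` that average tends to the nonzero constant
`secondDiff σ u t₀`. -/
theorem sq_mem_ridgeSpan {σ : C(ℝ, ℝ)} (hσ' : ¬ ∃ a b : ℝ, ∀ t, σ t = a * t + b) :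
    (⟨fun t => t ^ 2, by fun_prop⟩ : C(ℝ, ℝ)) ∈ ridgeSpan σ := by
  obtain ⟨u, t₀, h0⟩ := exists_secondDiff_ne_zero σ.continuous hσ'
  have hcsd : ∀ v, Continuous (secondDiff σ v) := fun v => by unfold secondDiff; fun_prop
  -- The first variable is the scale `h`, the second is `t`. Joint continuity makes `h ↦ Q (h, ·)`
  -- continuous into `C(ℝ, ℝ)`, so the value at `h = 0` is a limit of members of the closed span.
  let Q : ℝ × ℝ → ℝ := fun p => p.2 ^ 2 *
    ∫ s in (0 : ℝ)..1, ∫ s' in (0 : ℝ)..1, secondDiff σ u (t₀ + p.1 * p.2 * s + p.1 * p.2 * s')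
  have hQ : Continuous Q := by
    refine (continuous_snd.pow 2).mul ?_
    refine intervalIntegral.continuous_parametric_intervalIntegral_of_continuous' ?_ _ _
    refine intervalIntegral.continuous_parametric_intervalIntegral_of_continuous' ?_ _ _
    have := hcsd u
    simp only [Function.uncurry_def]
    fun_prop
  let q : ℝ → C(ℝ, ℝ) := fun h => ⟨fun t => Q (h, t), by fun_prop⟩
  have hq : Continuous q := ContinuousMap.continuous_of_continuous_uncurry _ hQ
  have hmem : ∀ h, h ≠ 0 → q h ∈ ridgeSpan σ := by
    intro h hh
    obtain ⟨Φ, hΦ, hΦV⟩ : ∃ Φ : ℝ → ℝ → C(ℝ, ℝ),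
        (∀ s s' t, Φ s s' t = secondDiff σ (h * t) (t₀ + u * s + u * s')) ∧
          ∀ s s', Φ s s' ∈ ridgeSpan σ := by
      refine ⟨fun s s' => ridge σ (2 * h) (t₀ + u * s + u * s') -
        (2 : ℝ) • ridge σ h (t₀ + u * s + u * s') + ridge σ 0 (t₀ + u * s + u * s'), ?_, ?_⟩
      · intro s s' t
        change σ _ - 2 * σ _ + σ _ = _
        unfold secondDiff
        ring_nf
      · exact fun s s' => add_mem (sub_mem (ridge_mem_ridgeSpan _ _ _)
          (Submodule.smul_mem _ _ (ridge_mem_ridgeSpan _ _ _))) (ridge_mem_ridgeSpan _ _ _)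
    have hΦc : Continuous fun p : (ℝ × ℝ) × ℝ => Φ p.1.1 p.2 p.1.2 := by
      simp_rw [hΦ, secondDiff]; fun_prop
    have hIc : Continuous fun p : ℝ × ℝ => ∫ s' in (0 : ℝ)..1, Φ p.1 s' p.2 :=
      intervalIntegral.continuous_parametric_intervalIntegral_of_continuous'
        (f := fun (p : ℝ × ℝ) s' => Φ p.1 s' p.2) hΦc 0 1
    let I : ℝ → C(ℝ, ℝ) := fun s => ⟨fun t => ∫ s' in (0 : ℝ)..1, Φ s s' t,
      hIc.comp (continuous_const.prodMk continuous_id)⟩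
    have hI : ∀ s, I s ∈ ridgeSpan σ := fun s =>
      average_mem_of_isClosed (isClosed_ridgeSpan σ) (Φ s)
        (ContinuousMap.continuous_of_continuous_uncurry _ (by
          have hp : Continuous fun p : ℝ × ℝ => ((s, p.2), p.1) := by fun_prop
          exact hΦc.comp hp))
        (hΦV s) _ fun t => rfl
    have hJc : Continuous fun t : ℝ => ∫ s in (0 : ℝ)..1, I s t :=
      intervalIntegral.continuous_parametric_intervalIntegral_of_continuous'
        (f := fun t s => I s t) (hIc.comp continuous_swap) 0 1
    have hJ : (⟨_, hJc⟩ : C(ℝ, ℝ)) ∈ ridgeSpan σ :=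
      average_mem_of_isClosed (isClosed_ridgeSpan σ) I
        (ContinuousMap.continuous_of_continuous_uncurry _ hIc) hI _ fun t => rfl
    have : q h = (u ^ 2 / h ^ 2) • (⟨_, hJc⟩ : C(ℝ, ℝ)) := by
      ext t
      change t ^ 2 * (∫ s in (0 : ℝ)..1, ∫ s' in (0 : ℝ)..1,
        secondDiff σ u (t₀ + h * t * s + h * t * s')) =
          u ^ 2 / h ^ 2 * ∫ s in (0 : ℝ)..1, ∫ s' in (0 : ℝ)..1, Φ s s' t
      simp_rw [hΦ]
      have := integral_integral_secondDiff σ.continuous u (h * t) t₀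
      rw [div_mul_eq_mul_div, eq_div_iff (pow_ne_zero 2 hh), ← this]
      ring
    rw [this]
    exact Submodule.smul_mem _ _ hJ
  have hq0 : q 0 ∈ ridgeSpan σ := by
    have hlim : Filter.Tendsto q (𝓝[≠] 0) (𝓝 (q 0)) := hq.continuousAt.mono_left nhdsWithin_le_nhds
    exact (isClosed_ridgeSpan σ).mem_of_tendsto hlim
      (eventually_nhdsWithin_of_forall fun h hh => hmem h hh)
  have : (⟨fun t => t ^ 2, by fun_prop⟩ : C(ℝ, ℝ)) = (secondDiff σ u t₀)⁻¹ • q 0 := by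
    ext t
    change t ^ 2 = (secondDiff σ u t₀)⁻¹ * (t ^ 2 * _)
    simp only [zero_mul, add_zero, intervalIntegral.integral_const, sub_zero, one_smul]
    field_simp
  rw [this]
  exact Submodule.smul_mem _ _ hq0

/-! ### Composition of networks -/

theorem continuous_act {σ : ℝ → ℝ} (hσ : Continuous σ) {n : ℕ} :
    Continuous (act σ : Vec n → Vec n) := by
  unfold act; fun_prop

namespace IsNeuralNetwork

variable {σ : ℝ → ℝ} {a b c : ℕ}

protected theorem continuous (hσ : Continuous σ) {g : Vec a → Vec b} (hg : IsNeuralNetwork σ g) :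
    Continuous g := by
  induction hg with
  | affine A c => exact A.continuous_of_finiteDimensional.add continuous_const
  | layer A w g _ ih =>
    exact ih.comp ((continuous_act hσ).comp
      (A.continuous_of_finiteDimensional.add continuous_const))

theorem linear (A : Vec a →ₗ[ℝ] Vec b) : IsNeuralNetwork σ A := by
  simpa using IsNeuralNetwork.affine (σ := σ) A 0

theorem comp_affine {g : Vec b → Vec c} (hg : IsNeuralNetwork σ g) (A : Vec a →ₗ[ℝ] Vec b)
    (w : Vec b) : IsNeuralNetwork σ fun x => g (A x + w) := by
  cases hg with
  | affine B d =>
    convert IsNeuralNetwork.affine (σ := σ) (B ∘ₗ A) (B w + d) using 2 with x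
    simp [add_assoc]
  | layer B d g hg =>
    convert IsNeuralNetwork.layer (σ := σ) (B ∘ₗ A) (B w + d) g hg using 4 with x
    simp [add_assoc]

theorem comp {g : Vec b → Vec c} {f : Vec a → Vec b} (hg : IsNeuralNetwork σ g)
    (hf : IsNeuralNetwork σ f) : IsNeuralNetwork σ fun x => g (f x) := by
  induction hf with
  | affine A w => exact hg.comp_affine A w
  | layer A w f _ ih => exact IsNeuralNetwork.layer A w _ (ih hg)

end IsNeuralNetwork

/-- Networks with at least one hidden layer. -/
def IsLayered (σ : ℝ → ℝ) {a c : ℕ} (N : Vec a → Vec c) : Prop :=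
  ∃ (b : ℕ) (A : Vec a →ₗ[ℝ] Vec b) (w : Vec b) (g : Vec b → Vec c),
    IsNeuralNetwork σ g ∧ ∀ x, N x = g (act σ (A x + w))

theorem IsLayered.isNeuralNetwork {σ : ℝ → ℝ} {a c : ℕ} {N : Vec a → Vec c} (h : IsLayered σ N) :
    IsNeuralNetwork σ N := by
  obtain ⟨b, A, w, g, hg, hN⟩ := h
  rw [funext hN]
  exact .layer A w g hg

theorem IsLayered.comp {σ : ℝ → ℝ} {a b c : ℕ} {g : Vec b → Vec c} {f : Vec a → Vec b}
    (hg : IsLayered σ g) (hf : IsLayered σ f) : IsLayered σ fun x => g (f x) := by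
  obtain ⟨k, A, w, f', hf', hf⟩ := hf
  exact ⟨k, A, w, fun y => g (f' y), hg.isNeuralNetwork.comp hf', fun x => by simp [hf]⟩

/-! ### Shallow networks and their limits -/

/-- The one-neuron network `x ↦ σ(ℓ x + b) v`. -/
def neuron (σ : C(ℝ, ℝ)) {n n' : ℕ} (ℓ : Vec n →ₗ[ℝ] ℝ) (b : ℝ) (v : Vec n') : C(Vec n, Vec n') :=
  ⟨fun x => σ (ℓ x + b) • v, by
    have := ℓ.continuous_of_finiteDimensional
    fun_prop⟩

/-- The span of the one-neuron networks. -/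
def shallowSpan (σ : C(ℝ, ℝ)) (n n' : ℕ) : Submodule ℝ C(Vec n, Vec n') :=
  Submodule.span ℝ (Set.range fun p : (Vec n →ₗ[ℝ] ℝ) × ℝ × Vec n' => neuron σ p.1 p.2.1 p.2.2)

theorem isLayered_of_mem_shallowSpan {σ : C(ℝ, ℝ)} {n n' : ℕ} {q : C(Vec n, Vec n')}
    (hq : q ∈ shallowSpan σ n n') : IsLayered σ q := by
  obtain ⟨k, f, g, rfl⟩ := Submodule.mem_span_set'.1 hq
  choose p hp using fun i => (g i).2
  refine ⟨k, (WithLp.linearEquiv 2 ℝ (Fin k → ℝ)).symm.toLinearMap ∘ₗ LinearMap.pi fun i => (p i).1,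
    WithLp.toLp 2 fun i => (p i).2.1,
    (∑ i, (LinearMap.proj i ∘ₗ (WithLp.linearEquiv 2 ℝ (Fin k → ℝ)).toLinearMap).smulRight
      (f i • (p i).2.2) : Vec k →ₗ[ℝ] Vec n'), .linear _, fun x => ?_⟩
  simp only [ContinuousMap.coe_sum, Finset.sum_apply, ContinuousMap.coe_smul, Pi.smul_apply,
    LinearMap.coe_sum, ← hp]
  refine Finset.sum_congr rfl fun i _ => ?_
  simp [neuron, act, smul_smul, mul_comm]

/-- The closed span of the one-neuron networks. -/
def shallowClosure (σ : C(ℝ, ℝ)) (n n' : ℕ) : Submodule ℝ C(Vec n, Vec n') :=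
  (shallowSpan σ n n').topologicalClosure

/-- The map `g ↦ neuron g ℓ b v` is linear and continuous and sends ridge functions to neurons, so
it sends the closed span of the former into that of the latter. -/
theorem smul_mem_shallowClosure {σ : C(ℝ, ℝ)} {n n' : ℕ} {g : C(ℝ, ℝ)} (hg : g ∈ ridgeSpan σ)
    (ℓ : Vec n →ₗ[ℝ] ℝ) (b : ℝ) (v : Vec n') : neuron g ℓ b v ∈ shallowClosure σ n n' := by
  let T : C(ℝ, ℝ) →ₗ[ℝ] C(Vec n, Vec n') :=
    { toFun := fun g => neuron g ℓ b v
      map_add' := fun g g' => by ext1 x; simp [neuron, add_smul]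
      map_smul' := fun c g => by ext1 x; simp [neuron, mul_smul] }
  have hT : Continuous T := by
    refine ContinuousMap.continuous_of_continuous_uncurry _ ?_
    have := ℓ.continuous_of_finiteDimensional
    have h : Continuous fun p : C(ℝ, ℝ) × Vec n => p.1 (ℓ p.2 + b) • v := by fun_prop
    exact h
  change T g ∈ closure _
  refine map_mem_closure hT hg ?_
  have : Submodule.span ℝ (Set.range fun p : ℝ × ℝ => ridge σ p.1 p.2) ≤
      (shallowSpan σ n n').comap T := by
    refine Submodule.span_le.2 ?_
    rintro _ ⟨⟨w, d⟩, rfl⟩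
    refine Submodule.subset_span ⟨(w • ℓ, w * b + d, v), ?_⟩
    ext1 x
    simp [T, neuron, ridge, mul_add, add_assoc]
  exact this

/-- The map `x ↦ (ℓ x + b) (ℓ' x + b') v`. -/
def quadratic {n n' : ℕ} (ℓ ℓ' : Vec n →ₗ[ℝ] ℝ) (b b' : ℝ) (v : Vec n') : C(Vec n, Vec n') :=
  ⟨fun x => ((ℓ x + b) * (ℓ' x + b')) • v, by
    have := ℓ.continuous_of_finiteDimensional
    have := ℓ'.continuous_of_finiteDimensional
    fun_prop⟩

/-- Polarization: `s t = ((s + t) ^ 2 - (s - t) ^ 2) / 4`. -/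
theorem quadratic_mem_shallowClosure {σ : C(ℝ, ℝ)}
    (hσ' : ¬ ∃ a b : ℝ, ∀ t, σ t = a * t + b) {n n' : ℕ} (ℓ ℓ' : Vec n →ₗ[ℝ] ℝ)
    (b b' : ℝ) (v : Vec n') : quadratic ℓ ℓ' b b' v ∈ shallowClosure σ n n' := by
  have h := sq_mem_ridgeSpan hσ'
  have : quadratic ℓ ℓ' b b' v =
      (1 / 4 : ℝ) • (neuron ⟨fun t => t ^ 2, by fun_prop⟩ (ℓ + ℓ') (b + b') v -
        neuron ⟨fun t => t ^ 2, by fun_prop⟩ (ℓ - ℓ') (b - b') v) := by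
    ext1 x
    simp only [quadratic, neuron, ContinuousMap.coe_mk, ContinuousMap.coe_smul,
      ContinuousMap.coe_sub, Pi.smul_apply, Pi.sub_apply, LinearMap.add_apply, LinearMap.sub_apply,
      ← sub_smul, smul_smul]
    congr 1
    ring
  rw [this]
  exact Submodule.smul_mem _ _ (sub_mem (smul_mem_shallowClosure h _ _ _)
    (smul_mem_shallowClosure h _ _ _))

/-- The limits, locally uniformly, of networks with at least one hidden layer. -/
def netClosure (σ : ℝ → ℝ) (a b : ℕ) : Set C(Vec a, Vec b) := closure {q | IsLayered σ q}

theorem mem_netClosure_of_mem_shallowClosure {σ : C(ℝ, ℝ)} {n n' : ℕ} {q : C(Vec n, Vec n')}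
    (hq : q ∈ shallowClosure σ n n') : q ∈ netClosure σ n n' :=
  closure_mono (fun _ h => isLayered_of_mem_shallowSpan h) hq

/-- Composition is jointly continuous in the compact-open topology because `ℝᵇ` is locally compact.
-/
theorem comp_mem_netClosure {σ : ℝ → ℝ} {a b c : ℕ} {g : C(Vec b, Vec c)} {f : C(Vec a, Vec b)}
    (hg : g ∈ netClosure σ b c) (hf : f ∈ netClosure σ a b) : g.comp f ∈ netClosure σ a c :=
  map_mem_closure₂ (f := fun (f : C(Vec a, Vec b)) (g : C(Vec b, Vec c)) => g.comp f)
    ContinuousMap.continuous_comp' hf hg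
    fun f hf g hg => IsLayered.comp (g := g) (f := f) hg hf

/-- The map with coordinates `(ℓᵢ x + bᵢ) (ℓᵢ' x + bᵢ')`. -/
theorem exists_mem_netClosure_quadratic {σ : C(ℝ, ℝ)} (hσ' : ¬ ∃ a b : ℝ, ∀ t, σ t = a * t + b)
    {n n' : ℕ} (ℓ ℓ' : Fin n' → Vec n →ₗ[ℝ] ℝ) (b b' : Fin n' → ℝ) :
    ∃ q ∈ netClosure σ n n', ∀ x i, q x i = (ℓ i x + b i) * (ℓ' i x + b' i) := by
  refine ⟨∑ i, quadratic (ℓ i) (ℓ' i) (b i) (b' i) (EuclideanSpace.single i 1),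
    mem_netClosure_of_mem_shallowClosure
      (Submodule.sum_mem _ fun i _ => quadratic_mem_shallowClosure hσ' _ _ _ _ _), fun x i => ?_⟩
  simp [quadratic, ContinuousMap.coe_sum, Finset.sum_apply, Pi.single_apply]

/-- The map with coordinates `ℓᵢ x + bᵢ`. -/
theorem exists_mem_netClosure_affine {σ : C(ℝ, ℝ)} (hσ' : ¬ ∃ a b : ℝ, ∀ t, σ t = a * t + b)
    {n n' : ℕ} (ℓ : Fin n' → Vec n →ₗ[ℝ] ℝ) (b : Fin n' → ℝ) :
    ∃ q ∈ netClosure σ n n', ∀ x i, q x i = ℓ i x + b i := by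
  obtain ⟨q, hq, h⟩ := exists_mem_netClosure_quadratic hσ' ℓ 0 b 1
  exact ⟨q, hq, fun x i => by simp [h]⟩

/-! ### Universal approximation -/

/-- The `i`-th coordinate, as a linear form. -/
def coordL {n : ℕ} (i : Fin n) : Vec n →ₗ[ℝ] ℝ :=
  LinearMap.proj i ∘ₗ (WithLp.linearEquiv 2 ℝ (Fin n → ℝ)).toLinearMap

@[simp] theorem coordL_apply {n : ℕ} (i : Fin n) (x : Vec n) : coordL i x = x i := rfl

/-- `f` can be appended to any approximable map from whose values the input can be read off. -/
def IsAppendable (σ : ℝ → ℝ) {a : ℕ} (f : C(Vec a, ℝ)) : Prop :=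
  ∀ (n : ℕ), ∀ F ∈ netClosure σ a n, (∃ ι : Fin a → Fin n, ∀ x i, F x (ι i) = x i) →
    ∃ G ∈ netClosure σ a (n + 1), ∀ x, (∀ i : Fin n, G x i.castSucc = F x i) ∧
      G x (Fin.last n) = f x

/-- Covers the generators of the polynomial algebra: coordinates (`some i`) and constants (`none`).
-/
theorem isAppendable_of_affine {σ : C(ℝ, ℝ)}
    (hσ' : ¬ ∃ a b : ℝ, ∀ t, σ t = a * t + b) {a : ℕ} (f : C(Vec a, ℝ))
    (hf : ∃ (i : Option (Fin a)) (b : ℝ), ∀ x, f x = (i.elim 0 fun i => x i) + b) :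
    IsAppendable σ f := by
  obtain ⟨i, b, hf⟩ := hf
  rintro n F hF ⟨ι, hι⟩
  obtain ⟨q, hq, h⟩ := exists_mem_netClosure_affine hσ' (n := n) (n' := n + 1)
    (Fin.snoc (α := fun _ => Vec n →ₗ[ℝ] ℝ) (fun j => coordL j) (i.elim 0 fun i => coordL (ι i)))
    (Fin.snoc (α := fun _ => ℝ) (fun _ => 0) b)
  refine ⟨q.comp F, comp_mem_netClosure hq hF, fun x => ⟨fun j => by simp [h], ?_⟩⟩
  cases i <;> simp [h, hf, hι]

/-- Append `f`, then `g`, then apply a quadratic map that keeps the first `n` coordinates and merges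
the last two into their sum or product. The input stays readable throughout, which allows `g` to be
appended after `f`. -/
theorem isAppendable_of_quadratic {σ : C(ℝ, ℝ)}
    (hσ' : ¬ ∃ a b : ℝ, ∀ t, σ t = a * t + b) {a : ℕ} {f g : C(Vec a, ℝ)} (hf : IsAppendable σ f)
    (hg : IsAppendable σ g) (k : C(Vec a, ℝ))
    (hk : (∀ x, k x = f x + g x) ∨ (∀ x, k x = f x * g x)) : IsAppendable σ k := by
  rintro n F hF ⟨ι, hι⟩
  obtain ⟨G, hG, hGF⟩ := hf n F hF ⟨ι, hι⟩
  obtain ⟨H, hH, hHG⟩ := hg (n + 1) G hG ⟨fun i => (ι i).castSucc, fun x i => by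
    rw [(hGF x).1, hι]⟩
  have hfl : ∀ x, H x (Fin.last n).castSucc = f x := fun x => by rw [(hHG x).1, (hGF x).2]
  obtain ⟨q, hq, h⟩ : ∃ q ∈ netClosure σ (n + 1 + 1) (n + 1),
      (∀ x, ∀ i : Fin n, q x i.castSucc = x i.castSucc.castSucc) ∧
        ∀ x, q (H x) (Fin.last n) = k x := by
    rcases hk with hk | hk
    · obtain ⟨q, hq, h⟩ := exists_mem_netClosure_affine hσ' (n := n + 1 + 1) (n' := n + 1)
        (Fin.snoc (α := fun _ => Vec (n + 1 + 1) →ₗ[ℝ] ℝ) (fun j => coordL j.castSucc.castSucc)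
          (coordL (Fin.last n).castSucc + coordL (Fin.last (n + 1)))) 0
      exact ⟨q, hq, fun x i => by simp [h], fun x => by
        simp only [h, Fin.snoc_last, LinearMap.add_apply, coordL_apply, hfl, (hHG x).2, hk]
        simp⟩
    · obtain ⟨q, hq, h⟩ := exists_mem_netClosure_quadratic hσ' (n := n + 1 + 1) (n' := n + 1)
        (Fin.snoc (α := fun _ => Vec (n + 1 + 1) →ₗ[ℝ] ℝ) (fun j => coordL j.castSucc.castSucc)
          (coordL (Fin.last n).castSucc))
        (Fin.snoc (α := fun _ => Vec (n + 1 + 1) →ₗ[ℝ] ℝ) (fun _ => 0) (coordL (Fin.last (n + 1))))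
        0 (Fin.snoc (α := fun _ => ℝ) (fun _ => 1) 0)
      exact ⟨q, hq, fun x i => by simp [h], fun x => by
        simp only [h, Fin.snoc_last, coordL_apply, hfl, (hHG x).2, hk]
        simp⟩
  exact ⟨q.comp H, comp_mem_netClosure hq hH, fun x => ⟨fun i => by
    simp [h.1, (hHG x).1, (hGF x).1], h.2 x⟩⟩

/-- Networks with a continuous non-affine activation are dense in the continuous functions. -/
theorem exists_isLayered_near {σ : C(ℝ, ℝ)}
    (hσ' : ¬ ∃ a b : ℝ, ∀ t, σ t = a * t + b) {a : ℕ} (f : C(Vec a, ℝ))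
    {K : Set (Vec a)} (hK : IsCompact K)
    {ε : ℝ} (hε : 0 < ε) :
    ∃ N : Vec a → Vec 1, IsLayered σ N ∧ ∀ x ∈ K, |N x 0 - f x| ≤ ε := by
  let coords : Set C(Vec a, ℝ) := Set.range fun i => ⟨fun x => x i, by fun_prop⟩
  have happ : ∀ g ∈ Algebra.adjoin ℝ coords, IsAppendable σ g := by
    intro g hg
    induction hg using Algebra.adjoin_induction with
    | mem g hg =>
      obtain ⟨i, rfl⟩ := hg
      exact isAppendable_of_affine hσ' _ ⟨some i, 0, fun x => by simp⟩
    | algebraMap c => exact isAppendable_of_affine hσ' _ ⟨none, c, fun x => by simp⟩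
    | add g k _ _ ihg ihk =>
      exact isAppendable_of_quadratic hσ' ihg ihk _ (Or.inl fun x => rfl)
    | mul g k _ _ ihg ihk =>
      exact isAppendable_of_quadratic hσ' ihg ihk _ (Or.inr fun x => rfl)
  have hsep : (Algebra.adjoin ℝ coords).SeparatesPoints := by
    intro x y hxy
    obtain ⟨i, hi⟩ : ∃ i, x i ≠ y i := by
      by_contra! h
      exact hxy (by ext i; exact h i)
    exact ⟨_, ⟨_, Algebra.subset_adjoin ⟨i, rfl⟩, rfl⟩, hi⟩
  obtain ⟨g, hg, hgf⟩ :=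
    ContinuousMap.exists_mem_subalgebra_near_continuous_of_isCompact_of_separatesPoints hsep f hK
      (half_pos hε)
  -- The polynomial `g` is appended to the identity, and its coordinate is then read off by `q₁`.
  obtain ⟨q₀, hq₀, h₀⟩ := exists_mem_netClosure_affine hσ' (n := a) (fun i => coordL i) 0
  obtain ⟨G, hG, hGg⟩ := happ g hg a q₀ hq₀ ⟨id, fun x i => by simp [h₀]⟩
  obtain ⟨q₁, hq₁, h₁⟩ := exists_mem_netClosure_affine hσ' (n := a + 1) (n' := 1)
    (fun _ => coordL (Fin.last a)) 0
  obtain ⟨N, hN, hNq⟩ := mem_closure_iff_forall_isCompact.1 (comp_mem_netClosure hq₁ hG) K hK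
    (ε / 2) (half_pos hε)
  refine ⟨N, hN, fun x hx => ?_⟩
  have e1 := hgf x hx
  have e2 : |q₁ (G x) 0 - N x 0| ≤ dist (q₁ (G x)) (N x) := by
    rw [← Real.dist_eq]
    simpa [dist_eq_norm] using PiLp.norm_apply_le (q₁ (G x) - N x) 0
  have e3 := hNq x hx
  rw [h₁, coordL_apply, (hGg x).2] at e2
  simp only [Pi.zero_apply, add_zero, ContinuousMap.comp_apply, Real.norm_eq_abs] at e1 e2 e3
  rw [abs_lt] at e1
  have e4 := abs_le.1 (e2.trans e3.le)
  rw [abs_le]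
  constructor <;> linarith [e1.1, e1.2, e4.1, e4.2]

/-! ### Lebesgue measure on compact sets -/

theorem map_val_leb {k : ℕ} (B : Compacts (Vec k)) :
    (leb B).map (Subtype.val : B → Vec k) = volume.restrict (B : Set (Vec k)) :=
  map_comap_subtype_coe B.isCompact.isClosed.measurableSet _

theorem measurableEmbedding_val {k : ℕ} (B : Compacts (Vec k)) :
    MeasurableEmbedding (Subtype.val : B → Vec k) :=
  .subtype_coe B.isCompact.isClosed.measurableSet

instance isFiniteMeasure_leb {k : ℕ} (B : Compacts (Vec k)) : IsFiniteMeasure (leb B) := by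
  refine ⟨?_⟩
  rw [leb, (measurableEmbedding_val B).comap_apply]
  exact (measure_mono (by rintro _ ⟨x, _, rfl⟩; exact x.2)).trans_lt B.isCompact.measure_lt_top

theorem integrable_leb {k : ℕ} {B : Compacts (Vec k)} {f : B → ℝ} (hf : Continuous f) :
    Integrable f (leb B) :=
  integrableOn_univ.1 (hf.continuousOn.integrableOn_compact isCompact_univ)

/-- A compact set with Lipschitz boundary has positive measure near each of its points. -/
theorem HasLipschitzBoundary.isOpenPosMeasure {k : ℕ} {B : Compacts (Vec k)}
    (hB : HasLipschitzBoundary (B : Set (Vec k))) : (leb B).IsOpenPosMeasure := by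
  refine ⟨fun U hU ⟨p, hp⟩ => ?_⟩
  obtain ⟨V, hV, rfl⟩ := isOpen_induced_iff.1 hU
  suffices h : ∃ W : Set (Vec k), IsOpen W ∧ W.Nonempty ∧ W ⊆ B ∩ V by
    obtain ⟨W, hWo, hWn, hW⟩ := h
    rw [leb, (measurableEmbedding_val B).comap_apply]
    refine ((hWo.measure_pos volume hWn).trans_le (measure_mono fun x hx => ?_)).ne'
    exact ⟨⟨x, (hW hx).1⟩, (hW hx).2, rfl⟩
  by_cases hpi : (p : Vec k) ∈ interior (B : Set (Vec k))
  · exact ⟨interior B ∩ V, isOpen_interior.inter hV, ⟨p, hpi, hp⟩,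
      Set.inter_subset_inter_left _ interior_subset⟩
  have hpf : (p : Vec k) ∈ frontier (B : Set (Vec k)) := ⟨subset_closure p.2, hpi⟩
  obtain ⟨v, hv, γ, ⟨K, hγ⟩, hev⟩ := hB p hpf
  have hpγ : inner ℝ v (p : Vec k) ≤
      γ ((Submodule.span ℝ {v})ᗮ.orthogonalProjectionOnto (p : Vec k)) :=
    (mem_of_mem_nhds hev).1 p.2
  obtain ⟨O, hO, hOo, hpO⟩ := eventually_nhds_iff.1 hev
  let P : Vec k → ↥(Submodule.span ℝ {v})ᗮ := (Submodule.span ℝ {v})ᗮ.orthogonalProjectionOnto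
  have hP : Continuous P := ContinuousLinearMap.continuous _
  -- The open strict subgraph lies locally in `B`. It meets every neighbourhood of `p`: moving from
  -- `p` by `-s • v` leaves the projection unchanged and lowers the height by `s`.
  refine ⟨{x | inner ℝ v x < γ (P x)} ∩ (O ∩ V), ?_, ?_, ?_⟩
  · refine (isOpen_lt ?_ (hγ.continuous.comp hP)).inter (hOo.inter hV)
    fun_prop
  · have hc : Filter.Tendsto (fun s : ℝ => (p : Vec k) - s • v) (𝓝[>] 0) (𝓝 p) := by
      have : Continuous fun s : ℝ => (p : Vec k) - s • v := by fun_prop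
      have h := this.tendsto 0
      simp only [zero_smul, sub_zero] at h
      exact h.mono_left nhdsWithin_le_nhds
    obtain ⟨s, hs, hs0⟩ := ((hc.eventually ((hOo.inter hV).mem_nhds ⟨hpO, hp⟩)).and
      (eventually_mem_nhdsWithin (a := (0 : ℝ)) (s := Set.Ioi 0))).exists
    refine ⟨p - s • v, ?_, hs⟩
    have hPv : P (p - s • v) = P p := by
      have : P v = 0 := by
        exact Submodule.orthogonalProjectionOnto_orthogonal_apply_eq_zero
          (Submodule.mem_span_singleton_self v)
      simp only [P] at this ⊢
      rw [map_sub, map_smul, this, smul_zero, sub_zero]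
    simp only [Set.mem_ofPred_eq, hPv, inner_sub_right, inner_smul_right,
      real_inner_self_eq_norm_sq, hv]
    have : (0 : ℝ) < s := hs0
    change _ < γ (P p)
    have h' : inner ℝ v (p : Vec k) ≤ γ (P p) := hpγ
    linarith
  · rintro x ⟨hx, hxO, hxV⟩
    exact ⟨(hO x hxO).2 (le_of_lt hx), hxV⟩

/-! ### Product domains -/

/-- The first `a` coordinates of a vector in `ℝᵃ⁺ᵇ`. -/
def vfirst {a b : ℕ} (z : Vec (a + b)) : Vec a := WithLp.toLp 2 fun i => z (Fin.castAdd b i)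

theorem continuous_vfirst {a b : ℕ} : Continuous (vfirst : Vec (a + b) → Vec a) := by
  unfold vfirst; fun_prop

theorem vfirst_vappend {a b : ℕ} (x : Vec a) (y : Vec b) : vfirst (vappend x y) = x := by
  ext i; simp [vfirst, vappend]

theorem vappend_injective {a b : ℕ} :
    Function.Injective fun q : Vec a × Vec b => vappend q.1 q.2 := by
  rintro ⟨x, y⟩ ⟨x', y'⟩ h
  have h' := fun i => congrArg (fun z : Vec (a + b) => z i) h
  refine Prod.ext ?_ ?_
  · ext i
    simpa [vappend] using h' (Fin.castAdd b i)
  · ext i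
    simpa [vappend] using h' (Fin.natAdd a i)

theorem norm_sq_vappend {a b : ℕ} (x : Vec a) (y : Vec b) :
    ‖vappend x y‖ ^ 2 = ‖x‖ ^ 2 + ‖y‖ ^ 2 := by
  simp [EuclideanSpace.norm_sq_eq, Fin.sum_univ_add, vappend]

theorem dist_vappend_le {a b : ℕ} (x x' : Vec a) (y y' : Vec b) :
    dist (vappend x y) (vappend x' y') ≤ dist x x' + dist y y' := by
  have h : vappend x y - vappend x' y' = vappend (x - x') (y - y') := by
    ext i
    refine Fin.addCases (fun i => ?_) (fun i => ?_) i <;> simp [vappend]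
  rw [dist_eq_norm, dist_eq_norm, dist_eq_norm, h]
  have := norm_sq_vappend (x - x') (y - y')
  nlinarith [norm_nonneg (x - x'), norm_nonneg (y - y'), norm_nonneg (vappend (x - x') (y - y'))]

theorem measurePreserving_vappend {a b : ℕ} :
    MeasurePreserving (fun q : Vec a × Vec b => vappend q.1 q.2) (volume.prod volume) volume := by
  have h1 : MeasurePreserving (Prod.map WithLp.ofLp WithLp.ofLp : Vec a × Vec b → _)
      (volume.prod volume) (volume.prod volume) :=
    (PiLp.volume_preserving_ofLp (Fin a)).prod (PiLp.volume_preserving_ofLp (Fin b))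
  have h2 := volume_measurePreserving_sumPiEquivProdPi_symm (fun _ : Fin a ⊕ Fin b => ℝ)
  have h3 := volume_measurePreserving_piCongrLeft (fun _ : Fin (a + b) => ℝ) finSumFinEquiv
  have h4 := PiLp.volume_preserving_toLp (Fin (a + b))
  have h := h4.comp (h3.comp (h2.comp h1))
  have e : (fun q : Vec a × Vec b => vappend q.1 q.2) =
      WithLp.toLp 2 ∘ MeasurableEquiv.piCongrLeft (fun _ => ℝ) finSumFinEquiv ∘
        (MeasurableEquiv.sumPiEquivProdPi fun _ => ℝ).symm ∘ Prod.map WithLp.ofLp WithLp.ofLp := by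
    funext q
    simp only [vappend, Function.comp_apply]
    congr 1
    funext i
    refine Fin.addCases (fun i => ?_) (fun i => ?_) i
    · rw [Fin.append_left, ← finSumFinEquiv_apply_left, MeasurableEquiv.piCongrLeft_apply_apply]
      rfl
    · rw [Fin.append_right, ← finSumFinEquiv_apply_right, MeasurableEquiv.piCongrLeft_apply_apply]
      rfl
  rw [e]
  exact h

section

variable {m r : ℕ} {D : Compacts (Vec m)} {E : Compacts (Vec r)}

@[simp] theorem sndPt_mkPt (x : D) (y : E) : sndPt (mkPt x y) = y :=
  Subtype.ext (vlast_vappend _ _)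

theorem exists_mkPt_eq (z : prodDom D E) : ∃ x y, mkPt x y = z := by
  obtain ⟨z, ⟨⟨x, y⟩, ⟨hx, hy⟩, rfl⟩⟩ := z
  exact ⟨⟨x, hx⟩, ⟨y, hy⟩, rfl⟩

/-- Both measures are pushed to `ℝᵐ⁺ʳ`, where they become the restriction of Lebesgue measure to `D
× E`; pushing forward along a measurable embedding loses nothing. -/
theorem measurePreserving_mkPt :
    MeasurePreserving (fun q : D × E => mkPt q.1 q.2) ((leb D).prod (leb E))
      (leb (prodDom D E)) := by
  refine ⟨continuous_mkPt.measurable, ?_⟩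
  have hemb : MeasurableEmbedding fun q : Vec m × Vec r => vappend q.1 q.2 :=
    continuous_vappend.measurableEmbedding vappend_injective
  have hmap : (((leb D).prod (leb E)).map fun q : D × E => mkPt q.1 q.2).map Subtype.val =
      (leb (prodDom D E)).map Subtype.val := by
    rw [map_val_leb, Measure.map_map measurable_subtype_coe continuous_mkPt.measurable]
    have := (measurePreserving_vappend (a := m) (b := r)).restrict_image_emb hemb
      ((D : Set (Vec m)) ×ˢ (E : Set (Vec r)))
    have hcoe : ((prodDom D E : Compacts (Vec (m + r))) : Set (Vec (m + r))) =
      (fun q : Vec m × Vec r => vappend q.1 q.2) '' ((D : Set (Vec m)) ×ˢ (E : Set (Vec r))) := rfl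
    rw [hcoe, ← this.map_eq, ← Measure.prod_restrict, ← map_val_leb, ← map_val_leb,
      Measure.map_prod_map _ _ measurable_subtype_coe measurable_subtype_coe,
      Measure.map_map hemb.measurable (measurable_subtype_coe.prodMap measurable_subtype_coe)]
    rfl
  have he := measurableEmbedding_val (prodDom D E)
  rw [← he.comap_map (((leb D).prod (leb E)).map fun q : D × E => mkPt q.1 q.2), hmap,
    he.comap_map]

theorem integral_prodDom {f : prodDom D E → ℝ} (hf : Continuous f) :
    ∫ z, f z ∂(leb (prodDom D E)) = ∫ y, ∫ x, f (mkPt x y) ∂(leb D) ∂(leb E) := by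
  rw [← measurePreserving_mkPt.map_eq, integral_map continuous_mkPt.measurable.aemeasurable
    hf.aestronglyMeasurable]
  have hc : Continuous fun q : D × E => f (mkPt q.1 q.2) := hf.comp continuous_mkPt
  exact integral_prod_symm _
    (integrableOn_univ.1 (hc.continuousOn.integrableOn_compact isCompact_univ))

end

/-! ### Averaging kernels -/

/-- As `K` has mass one, the difference is the integral of `(f - c) * K`. -/
theorem abs_integral_mul_sub_le {X : Type*} [MeasurableSpace X] {μ : Measure X} {K f : X → ℝ}
    (hK : Integrable K μ) (hfK : Integrable (fun x => f x * K x) μ) (hK0 : ∀ x, 0 ≤ K x)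
    (hK1 : ∫ x, K x ∂μ = 1) {c η : ℝ} (h : ∀ x, K x ≠ 0 → |f x - c| ≤ η) :
    |∫ x, f x * K x ∂μ - c| ≤ η := by
  have e : ∫ x, f x * K x ∂μ - c = ∫ x, (f x - c) * K x ∂μ := by
    simp_rw [sub_mul]
    rw [integral_sub hfK (hK.const_mul c), integral_const_mul, hK1, mul_one]
  rw [e]
  calc |∫ x, (f x - c) * K x ∂μ| ≤ ∫ x, η * K x ∂μ := by
        rw [← Real.norm_eq_abs]
        refine norm_integral_le_of_norm_le (hK.const_mul η) (.of_forall fun x => ?_)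
        rw [Real.norm_eq_abs, abs_mul, abs_of_nonneg (hK0 x)]
        by_cases hx : K x = 0
        · simp [hx]
        · exact mul_le_mul_of_nonneg_right (h x hx) (hK0 x)
    _ = η := by rw [integral_const_mul, hK1, mul_one]

/-- A kernel of finite rank that averages at a scale below `η`. -/
structure AveragingKernel {k : ℕ} (B : Compacts (Vec k)) (η : ℝ) where
  /-- the rank -/
  rank : ℕ
  /-- the decoding functions -/
  out : Fin rank → C(Vec k, ℝ)
  /-- the encoding functions -/
  enc : Fin rank → C(Vec k, ℝ)
  nonneg : ∀ y y', 0 ≤ ∑ l, out l y * enc l y'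
  integral_eq_one : ∀ y ∈ B, ∫ y' : B, ∑ l, out l y * enc l y' ∂(leb B) = 1
  dist_lt : ∀ y y', ∑ l, out l y * enc l y' ≠ 0 → dist y y' < η

/-- The value of an averaging kernel. -/
def AveragingKernel.val {k : ℕ} {B : Compacts (Vec k)} {η : ℝ} (κ : AveragingKernel B η)
    (y y' : Vec k) : ℝ := ∑ l, κ.out l y * κ.enc l y'

theorem AveragingKernel.continuous_val {k : ℕ} {B : Compacts (Vec k)} {η : ℝ}
    (κ : AveragingKernel B η) : Continuous fun p : Vec k × Vec k => κ.val p.1 p.2 := by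
  unfold AveragingKernel.val; fun_prop

/-- Take `∑ φ_l(y) φ_l(y') / ∫ φ_l` for a partition of unity on `B` subordinate to balls of radius
`η / 2`. Integrating in `y'` leaves `∑ φ_l(y) = 1`, and a nonzero term puts `y` and `y'` in the same
ball. -/
theorem exists_averagingKernel {k : ℕ} (B : Compacts (Vec k)) (hB : (leb B).IsOpenPosMeasure)
    {η : ℝ} (hη : 0 < η) : Nonempty (AveragingKernel B η) := by
  rcases (B : Set (Vec k)).eq_empty_or_nonempty with hBe | hBn
  · have he : ∀ y, y ∉ B := fun y hy => by
      have : y ∈ (B : Set (Vec k)) := hy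
      simp [hBe] at this
    exact ⟨⟨0, Fin.elim0, Fin.elim0, by simp, fun y hy => (he y hy).elim, by simp⟩⟩
  obtain ⟨t, htB, htf, ht⟩ := finite_cover_balls_of_compact B.isCompact (half_pos hη)
  have := htf.fintype
  let c : Fin (Fintype.card t) → Vec k := fun l => ((Fintype.equivFin t).symm l).1
  let b : Fin (Fintype.card t) → Vec k → ℝ := fun l y => max 0 (η / 2 - dist y (c l))
  have hb0 : ∀ l y, 0 ≤ b l y := fun l y => le_max_left _ _
  have hbc : ∀ l, Continuous (b l) := fun l => by fun_prop
  have hbd : ∀ l y, b l y ≠ 0 → dist y (c l) < η / 2 := fun l y h => by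
    by_contra! h'
    exact h (max_eq_left (by linarith))
  have hbB : ∀ y ∈ B, 0 < ∑ l, b l y := fun y hy => by
    obtain ⟨x, hx, hyx⟩ := Set.mem_iUnion₂.1 (ht hy)
    refine Finset.sum_pos' (fun l _ => hb0 l y) ⟨Fintype.equivFin t ⟨x, hx⟩, Finset.mem_univ _, ?_⟩
    simp only [b, c, Equiv.symm_apply_apply]
    exact lt_max_of_lt_right (sub_pos.2 hyx)
  -- The distance to `B` keeps the denominator positive off `B` and vanishes on `B`, so the `φ l`
  -- are continuous on the whole space and sum to one on `B`.
  let s : Vec k → ℝ := fun y => ∑ l, b l y + Metric.infDist y B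
  have hs : ∀ y, 0 < s y := fun y => by
    by_cases hy : y ∈ B
    · exact add_pos_of_pos_of_nonneg (hbB y hy) Metric.infDist_nonneg
    · exact add_pos_of_nonneg_of_pos (Finset.sum_nonneg fun l _ => hb0 l y)
        ((B.isCompact.isClosed.notMem_iff_infDist_pos hBn).1 hy)
  have hsc : Continuous s :=
    (continuous_finsetSum _ fun l _ => hbc l).add (Metric.continuous_infDist_pt _)
  let φ : Fin (Fintype.card t) → C(Vec k, ℝ) := fun l =>
    ⟨fun y => b l y / s y, (hbc l).div hsc fun y => (hs y).ne'⟩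
  have hφ0 : ∀ l y, 0 ≤ φ l y := fun l y => div_nonneg (hb0 l y) (hs y).le
  have hφb : ∀ l y, φ l y ≠ 0 → dist y (c l) < η / 2 := fun l y h =>
    hbd l y fun h0 => h (by simp [φ, h0])
  have hφ1 : ∀ y ∈ B, ∑ l, φ l y = 1 := fun y hy => by
    have h : s y = ∑ l, b l y := by
      simp only [s]
      rw [Metric.infDist_zero_of_mem (show y ∈ (B : Set (Vec k)) from hy), add_zero]
    simp only [φ, ContinuousMap.coe_mk]
    rw [← Finset.sum_div, ← h, div_self (hs y).ne']
  have hφc : ∀ l, Continuous fun y : B => φ l y := fun l =>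
    (φ l).continuous.comp continuous_subtype_val
  -- The centre `c l` lies in `B` and `φ l` is positive there; nonempty open subsets of `B` have
  -- positive measure.
  have hI : ∀ l, 0 < ∫ y : B, φ l y ∂(leb B) := fun l => by
    refine (hφc l).integral_pos_of_hasCompactSupport_nonneg_nonzero
      (HasCompactSupport.of_compactSpace _) (fun y => hφ0 l y)
      (x := ⟨c l, htB (Subtype.coe_prop _)⟩) ?_
    have : 0 < b l (c l) := by simp [b, hη]
    exact (div_pos this (hs _)).ne'
  refine ⟨⟨Fintype.card t, φ, fun l => (∫ y : B, φ l y ∂(leb B))⁻¹ • φ l, ?_, ?_, ?_⟩⟩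
  · exact fun y y' => Finset.sum_nonneg fun l _ =>
      mul_nonneg (hφ0 l y) (mul_nonneg (inv_nonneg.2 (hI l).le) (hφ0 l y'))
  · intro y hy
    simp only [ContinuousMap.coe_smul, Pi.smul_apply, smul_eq_mul]
    rw [integral_finsetSum _ fun l _ => ((integrable_leb (hφc l)).const_mul _).const_mul _]
    simp_rw [integral_const_mul]
    rw [← hφ1 y hy]
    exact Finset.sum_congr rfl fun l _ => by rw [inv_mul_cancel₀ (hI l).ne', mul_one]
  · intro y y' h
    obtain ⟨l, -, hl⟩ := Finset.exists_ne_zero_of_sum_ne_zero h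
    have h1 := hφb l y (left_ne_zero_of_mul hl)
    have h2 := hφb l y' (right_ne_zero_of_mul (right_ne_zero_of_mul hl))
    have := dist_triangle_right y y' (c l)
    linarith

/-! ### Hölder balls -/

theorem mem_holderBall_iff {k : ℕ} {B : Compacts (Vec k)} {α R : ℝ} (hα : 0 < α) (hR : 0 ≤ R)
    {f : C(B, ℝ)} : f ∈ holderBall B α R ↔
      (∀ z, |f z| ≤ R) ∧ ∀ z z', |f z - f z'| ≤ R * dist z z' ^ α := by
  have h1 : ‖f‖ₑ ≤ ENNReal.ofReal R ↔ ∀ z, |f z| ≤ R := by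
    rw [← ofReal_norm, ENNReal.ofReal_le_ofReal_iff hR, ContinuousMap.norm_le _ hR]
    rfl
  have h2 : ∀ z z' : B, z ≠ z' → (‖f z - f z'‖ₑ / edist z z' ^ α ≤ ENNReal.ofReal R ↔
      |f z - f z'| ≤ R * dist z z' ^ α) := fun z z' h => by
    have hd : 0 < dist z z' := dist_pos.2 h
    have hdα : 0 < dist z z' ^ α := Real.rpow_pos_of_pos hd α
    rw [edist_dist, ENNReal.ofReal_rpow_of_pos hd, ← ofReal_norm,
      ← ENNReal.ofReal_div_of_pos hdα, ENNReal.ofReal_le_ofReal_iff hR, div_le_iff₀ hdα]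
    rfl
  rw [holderBall, Set.mem_ofPred_eq, holderENorm, max_le_iff, h1]
  simp only [iSup_le_iff]
  refine and_congr_right fun _ => forall₂_congr fun z z' => ?_
  by_cases h : z = z'
  · simp [h, Real.zero_rpow hα.ne']
  · simp [h, h2 z z' h]

theorem isCompact_holderBall {k : ℕ} (B : Compacts (Vec k)) {α R : ℝ} (hα : 0 < α) (hR : 0 ≤ R) :
    IsCompact (holderBall B α R) := by
  have hlim : Filter.Tendsto (fun d : ℝ => R * d ^ α) (𝓝 0) (𝓝 0) := by
    have h : Continuous fun d : ℝ => R * d ^ α :=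
      continuous_const.mul (Real.continuous_rpow_const hα.le)
    simpa [Real.zero_rpow hα.ne'] using h.tendsto 0
  refine ArzelaAscoli.isCompact_of_equicontinuous _ ?_ ?_
  · have himage : ContinuousMap.toFun '' holderBall B α R =
        {f : B → ℝ | (∀ z, |f z| ≤ R) ∧ ∀ z z', |f z - f z'| ≤ R * dist z z' ^ α} := by
      ext f
      constructor
      · rintro ⟨g, hg, rfl⟩
        exact (mem_holderBall_iff hα hR).1 hg
      · intro hf
        have hc : Continuous f := by
          refine continuous_iff_continuousAt.2 fun z => ?_
          refine tendsto_iff_dist_tendsto_zero.2 (squeeze_zero (fun _ => dist_nonneg)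
            (fun z' => hf.2 z' z) (hlim.comp ?_))
          exact tendsto_iff_dist_tendsto_zero.1 Filter.tendsto_id
        exact ⟨⟨f, hc⟩, (mem_holderBall_iff hα hR).2 hf, rfl⟩
    rw [himage]
    refine (isCompact_univ_pi fun _ : B => isCompact_Icc (a := -R) (b := R)).of_isClosed_subset
      ?_ fun f hf z _ => abs_le.1 (hf.1 z)
    simp only [Set.ofPred_and, Set.ofPred_forall]
    refine (isClosed_iInter fun z => isClosed_le ?_ continuous_const).inter
      (isClosed_iInter fun z => isClosed_iInter fun z' => isClosed_le ?_ continuous_const) <;>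
    fun_prop
  · exact Metric.equicontinuous_of_continuity_modulus (fun d => R * d ^ α) hlim _
      fun z z' f => ((mem_holderBall_iff hα hR).1 f.2).2 z z'

/-! ### Closedness of the set of densities -/

theorem continuous_integral_coe {X : Type*} [TopologicalSpace X] [CompactSpace X]
    [T2Space X] [MeasurableSpace X] [BorelSpace X] (μ : Measure X) [IsFiniteMeasure μ] :
    Continuous fun f : C(X, ℝ) => ∫ x, f x ∂μ := by
  have hi : ∀ f : C(X, ℝ), Integrable f μ := fun f =>
    integrableOn_univ.1 (f.continuous.continuousOn.integrableOn_compact isCompact_univ)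
  refine (LipschitzWith.of_dist_le_mul (K := (μ.real Set.univ).toNNReal) fun f g => ?_).continuous
  rw [dist_eq_norm, ← integral_sub (hi f) (hi g), Real.coe_toNNReal _ measureReal_nonneg, mul_comm,
    dist_eq_norm]
  exact norm_integral_le_of_norm_le_const (.of_forall fun x => (f - g).norm_coe_le_norm x)

section

variable {m r : ℕ} {D : Compacts (Vec m)} {E : Compacts (Vec r)}

theorem isClosed_densitiesGE (δ : ℝ) : IsClosed (densitiesGE D E δ) := by
  have h1 : IsClosed {ρ : C(prodDom D E, ℝ) | ∫ z, ρ z ∂(leb (prodDom D E)) = 1} :=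
    isClosed_eq (continuous_integral_coe _) continuous_const
  have h2 : IsClosed {ρ : C(prodDom D E, ℝ) | ∀ z, 0 ≤ ρ z} := by
    simp only [Set.ofPred_forall]
    exact isClosed_iInter fun z => isClosed_le continuous_const (by fun_prop)
  have h3 : IsClosed {ρ : C(prodDom D E, ℝ) | ∀ y : E, δ ≤ marginal ρ y} := by
    simp only [Set.ofPred_forall]
    refine isClosed_iInter fun y => isClosed_le continuous_const ?_
    let j : C(D, prodDom D E) := ⟨fun x => mkPt x y,
      continuous_mkPt.comp (continuous_id.prodMk continuous_const)⟩
    exact (continuous_integral_coe (leb D)).comp (ContinuousMap.continuous_precomp j)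
  exact (h1.inter h2).inter h3

theorem continuous_mkPt_left (y : E) : Continuous fun x : D => mkPt x y :=
  continuous_mkPt.comp (continuous_id.prodMk continuous_const)

/-! ### Bounds for marginals -/

theorem dist_mkPt_le (x x' : D) (y y' : E) :
    dist (mkPt x y) (mkPt x' y') ≤ dist x x' + dist y y' :=
  dist_vappend_le _ _ _ _

theorem abs_marginal_le {ρ : C(prodDom D E, ℝ)} {C : ℝ} (h : ∀ z, |ρ z| ≤ C) (y : E) :
    |marginal ρ y| ≤ C * (leb D).real Set.univ := by
  rw [← Real.norm_eq_abs]
  exact norm_integral_le_of_norm_le_const (.of_forall fun _ => h _)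

theorem abs_marginal_sub_le {ρ : C(prodDom D E, ℝ)} {C : ℝ} {y y' : E}
    (h : ∀ x : D, |ρ (mkPt x y) - ρ (mkPt x y')| ≤ C) :
    |marginal ρ y - marginal ρ y'| ≤ C * (leb D).real Set.univ := by
  unfold marginal
  have hi : ∀ y, Integrable (fun x => ρ (mkPt x y)) (leb D) := fun y =>
    integrable_leb (ρ.continuous.comp (continuous_mkPt_left y))
  rw [← integral_sub (hi y) (hi y'), ← Real.norm_eq_abs]
  exact norm_integral_le_of_norm_le_const (.of_forall h)

/-- The marginal of `ρ`, averaged at scale `η`. -/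
theorem abs_integral_mul_averagingKernel_sub_marginal_le {ρ : C(prodDom D E, ℝ)} {C η : ℝ}
    (κ : AveragingKernel E η) (y : E)
    (h : ∀ x y', dist y y' < η → |ρ (mkPt x y') - ρ (mkPt x y)| ≤ C) :
    |∫ z, ρ z * κ.val y (sndPt z) ∂(leb (prodDom D E)) - marginal ρ y| ≤
      C * (leb D).real Set.univ := by
  have hκ : Continuous fun y' : E => κ.val y y' :=
    κ.continuous_val.comp (continuous_const.prodMk continuous_subtype_val)
  rw [integral_prodDom (f := fun z => ρ z * κ.val y (sndPt z))
    (ρ.continuous.mul (hκ.comp continuous_sndPt))]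
  simp only [sndPt_mkPt, integral_mul_const]
  exact abs_integral_mul_sub_le (f := marginal ρ) (integrable_leb hκ)
    (integrable_leb ((continuous_marginal ρ).mul hκ)) (fun y' => κ.nonneg y y')
    (κ.integral_eq_one y y.2) fun y' hy' =>
      abs_marginal_sub_le fun x => h x y' (κ.dist_lt _ _ hy')

/-- The first component of a point of `D × E`. -/
def fstPt (z : prodDom D E) : Vec m := vfirst z.1

theorem continuous_fstPt : Continuous (fstPt : prodDom D E → Vec m) :=
  continuous_vfirst.comp continuous_subtype_val

@[simp] theorem fstPt_mkPt (x : D) (y : E) : fstPt (mkPt x y) = x :=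
  vfirst_vappend _ _

/-- The point value of `ρ`, averaged at scale `η`. -/
theorem abs_integral_mul_averagingKernels_sub_le {ρ : C(prodDom D E, ℝ)} {C η η' : ℝ}
    (κ : AveragingKernel D η) (κ' : AveragingKernel E η') (x : D) (y : E)
    (h : ∀ x' y', dist x x' < η → dist y y' < η' → |ρ (mkPt x' y') - ρ (mkPt x y)| ≤ C) :
    |∫ z, ρ z * (κ.val x (fstPt z) * κ'.val y (sndPt z)) ∂(leb (prodDom D E)) - ρ (mkPt x y)| ≤
      C := by
  have hκ : Continuous fun z : prodDom D E => κ.val x (fstPt z) :=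
    κ.continuous_val.comp (continuous_const.prodMk continuous_fstPt)
  have hκ' : Continuous fun z : prodDom D E => κ'.val y (sndPt z) :=
    κ'.continuous_val.comp (continuous_const.prodMk (continuous_subtype_val.comp continuous_sndPt))
  have hK : Continuous fun z : prodDom D E => κ.val x (fstPt z) * κ'.val y (sndPt z) :=
    hκ.mul hκ'
  have hρK : Continuous fun z : prodDom D E =>
      ρ z * (κ.val x (fstPt z) * κ'.val y (sndPt z)) := ρ.continuous.mul hK
  refine abs_integral_mul_sub_le (f := ρ) (integrable_leb hK) (integrable_leb hρK)
    (fun z => mul_nonneg (κ.nonneg _ _) (κ'.nonneg _ _)) ?_ fun z hz => ?_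
  · rw [integral_prodDom hK]
    simp only [sndPt_mkPt, fstPt_mkPt, integral_mul_const]
    have h1 : ∫ x' : D, κ.val x x' ∂(leb D) = 1 := κ.integral_eq_one x x.2
    simp only [h1, one_mul]
    exact κ'.integral_eq_one y y.2
  · obtain ⟨x', y', rfl⟩ := exists_mkPt_eq z
    simp only [sndPt_mkPt, fstPt_mkPt] at hz
    exact h x' y' (κ.dist_lt _ _ (left_ne_zero_of_mul hz))
      (κ'.dist_lt _ _ (right_ne_zero_of_mul hz))

theorem integral_averagingKernel_fst {η : ℝ} (κ : AveragingKernel D η) (x : D) :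
    ∫ z : prodDom D E, κ.val x (fstPt z) ∂(leb (prodDom D E)) = (leb E).real Set.univ := by
  rw [integral_prodDom (f := fun z => κ.val x (fstPt z))
    (κ.continuous_val.comp (continuous_const.prodMk continuous_fstPt))]
  have h1 : ∫ x' : D, κ.val x x' ∂(leb D) = 1 := κ.integral_eq_one x x.2
  simp [h1]

end

/-! ### Neural operators of depth one -/

/-- `vlast` as a linear map. -/
def vlastL (a b : ℕ) : Vec (a + b) →ₗ[ℝ] Vec b where
  toFun := vlast
  map_add' _ _ := rfl
  map_smul' _ _ := rfl

/-- Postcomposition with a continuous map. -/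
def postcomp {p d d' : ℕ} {Ω : Compacts (Vec p)} {g : Vec d → Vec d'} (hg : Continuous g)
    (f : C(Ω, Vec d)) : C(Ω, Vec d') := ⟨fun x => g (f x), hg.comp f.continuous⟩

theorem isPointwiseLayer_postcomp {σ : ℝ → ℝ} {p d d' : ℕ} {Ω : Compacts (Vec p)}
    {g : Vec d → Vec d'} (hg : IsNeuralNetwork σ g) (hgc : Continuous g) :
    IsPointwiseLayer σ (postcomp (Ω := Ω) hgc) :=
  ⟨fun z => g (vlast z), hg.comp (IsNeuralNetwork.linear (vlastL p d)), fun f x => by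
    simp [postcomp, vlast_vappend]⟩

theorem isPointwiseLayer_id {σ : ℝ → ℝ} {p d : ℕ} {Ω : Compacts (Vec p)} :
    IsPointwiseLayer σ (id : C(Ω, Vec d) → C(Ω, Vec d)) :=
  ⟨vlast, IsNeuralNetwork.linear (vlastL p d), fun _ _ => (vlast_vappend _ _).symm⟩

theorem toVec_apply {p : ℕ} {Ω : Compacts (Vec p)} (f : C(Ω, ℝ)) (x : Ω) (i : Fin 1) :
    toVec f x i = f x := rfl

theorem pairing_toVec {p : ℕ} {Ω : Compacts (Vec p)} (f : C(Ω, Vec 1)) (g : C(Ω, ℝ)) :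
    pairing (fun u => (LinearMap.id : Vec 1 →ₗ[ℝ] Vec 1) (f u)) (toVec g) =
      ∫ u, f u 0 * g u ∂(leb Ω) := by
  unfold pairing
  refine integral_congr_ae (.of_forall fun u => ?_)
  simp [PiLp.inner_apply, toVec_apply, mul_comm]

/-- The hidden layer plays the first layer of `N`, and the rest of `N` is the projection. This is
why `N` needs a hidden layer of its own. -/
theorem exists_isScalarNeuralOperator {σ : ℝ → ℝ} (hσ : Continuous σ) {N : Vec 2 → Vec 1}
    (hN : IsLayered σ N) {p M : ℕ} {Ω : Compacts (Vec p)} (ψ φ : Fin M → C(Ω, ℝ)) :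
    ∃ Ψ : C(Ω, ℝ) → C(Ω, ℝ), IsScalarNeuralOperator σ 1 Ψ ∧ ∀ f x,
      Ψ f x = N !₂[f x, ∑ k, (∫ u, f u * ψ k u ∂(leb Ω)) * φ k x] 0 := by
  obtain ⟨d, A, w, g, hg, hN⟩ := hN
  have hgc := hg.continuous hσ
  -- `A` is split by columns: the first becomes the local weight, the second multiplies the decoding
  -- functions.
  let W : Vec 1 →ₗ[ℝ] Vec d := (coordL 0).smulRight (A !₂[1, 0])
  have hWc : Continuous W := W.continuous_of_finiteDimensional
  let H : C(Ω, Vec 1) → C(Ω, Vec d) := fun f => ⟨fun x => act σ (W (f x) + w +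
    ∑ k, pairing (fun u => (LinearMap.id : Vec 1 →ₗ[ℝ] Vec 1) (f u)) (toVec (ψ k)) •
      (φ k x • A !₂[0, 1])), (continuous_act hσ).comp (by fun_prop)⟩
  have hH : IsHiddenLayer σ H :=
    ⟨W, w, M, fun _ => LinearMap.id, fun k => toVec (ψ k),
      fun k => ⟨fun x => φ k x • A !₂[0, 1], by fun_prop⟩, fun f x => rfl⟩
  let Φ : C(Ω, Vec 1) → C(Ω, Vec 1) := postcomp hgc ∘ (H ∘ id) ∘ id
  refine ⟨fun f => ⟨fun x => Φ (toVec f) x 0, by fun_prop⟩, ⟨Φ, ⟨one_pos, 1, d, id, H ∘ id,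
    postcomp hgc, isPointwiseLayer_id, .snoc id H .nil hH, isPointwiseLayer_postcomp hg hgc, rfl⟩,
    fun f => ?_⟩, fun f x => ?_⟩
  · ext x i
    rw [Subsingleton.elim i 0]
    rfl
  · rw [hN]
    change g (act σ (W (toVec f x) + w +
      ∑ k, pairing (fun u => (LinearMap.id : Vec 1 →ₗ[ℝ] Vec 1) (toVec f u)) (toVec (ψ k)) •
        (φ k x • A !₂[0, 1]))) 0 = _
    refine congrArg (fun v => g (act σ v) 0) ?_
    have e : A !₂[f x, ∑ k, (∫ u, f u * ψ k u ∂(leb Ω)) * φ k x] =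
        f x • A !₂[1, 0] + (∑ k, (∫ u, f u * ψ k u ∂(leb Ω)) * φ k x) • A !₂[0, 1] := by
      rw [← map_smul, ← map_smul, ← map_add]
      congr 1
      ext i
      fin_cases i <;> simp
    rw [e, Finset.sum_smul, add_right_comm]
    congr 2
    refine Finset.sum_congr rfl fun k _ => ?_
    rw [pairing_toVec, smul_smul]
    rfl

/-- With `h = 1` and `ψ` the identity, `V(z)` is the constant function `z`, so the lifting `N₁` sees
the point, the value of `f` and `z`. The transfer layer is the first layer of `N₂`. -/
theorem exists_isScalarAugNeuralOperator {σ : ℝ → ℝ} (hσ : Continuous σ) {p p' n M : ℕ}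
    {N₁ : Vec (p + (1 + n)) → Vec 1} (hN₁ : IsNeuralNetwork σ N₁) {N₂ : Vec 2 → Vec 1}
    (hN₂ : IsLayered σ N₂) {Ω : Compacts (Vec p)} {Ω' : Compacts (Vec p')} {Z : Compacts (Vec n)}
    (ψ : Fin M → C(Ω, ℝ)) (φ : Fin M → C(Ω', Vec 2)) :
    ∃ Ψt : C(Ω, ℝ) × Z → C(Ω', ℝ), IsScalarAugNeuralOperator σ 1 Ψt ∧ ∀ f z x,
      Ψt (f, z) x = N₂ (∑ k,
        (∫ u : Ω, N₁ (vappend u (vappend (toVec f u) z)) 0 * ψ k u ∂(leb Ω)) • φ k x) 0 := by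
  obtain ⟨d, A, w, g, hg, hN₂⟩ := hN₂
  have hgc := hg.continuous hσ
  have hN₁c := hN₁.continuous hσ
  have hAc : Continuous A := A.continuous_of_finiteDimensional
  let R : C(Ω, Vec (1 + n)) → C(Ω, Vec 1) := fun f => ⟨fun x => N₁ (vappend x (f x)),
    hN₁c.comp (continuous_vappend.comp (continuous_subtype_val.prodMk f.continuous))⟩
  let T : C(Ω, Vec 1) → C(Ω', Vec d) := fun f => ⟨fun x => act σ (w +
    ∑ k, pairing (fun u => (LinearMap.id : Vec 1 →ₗ[ℝ] Vec 1) (f u)) (toVec (ψ k)) •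
      A (φ k x)), (continuous_act hσ).comp (by fun_prop)⟩
  have hT : IsTransferLayer σ T :=
    ⟨w, M, fun _ => LinearMap.id, fun k => toVec (ψ k),
      fun k => ⟨fun x => A (φ k x), by fun_prop⟩, fun f x => rfl⟩
  let Φ₀ : C(Ω, Vec (1 + n)) → C(Ω', Vec 1) := postcomp hgc ∘ T ∘ id ∘ R
  let Φ : C(Ω, Vec 1) × Z → C(Ω', Vec 1) := fun q => Φ₀ (concat q.1 (vecToFun 1 q.2.1))
  refine ⟨fun q => ⟨fun x => Φ (toVec q.1, q.2) x 0, by fun_prop⟩, ⟨Φ, ⟨n, 1, fun z => z, Φ₀,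
    IsNeuralNetwork.linear LinearMap.id, ⟨one_pos, 1, 1, d, R, id, T, postcomp hgc,
      ⟨N₁, hN₁, fun f x => rfl⟩, .nil, hT, isPointwiseLayer_postcomp hg hgc, rfl⟩,
    fun f z => rfl⟩, fun f z => ?_⟩, fun f z x => ?_⟩
  · ext x i
    rw [Subsingleton.elim i 0]
    rfl
  · rw [hN₂]
    change g (act σ (w + ∑ k,
      pairing (fun u => (LinearMap.id : Vec 1 →ₗ[ℝ] Vec 1)
        (R (concat (toVec f) (vecToFun 1 z.1)) u)) (toVec (ψ k)) • A (φ k x))) 0 = _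
    refine congrArg (fun v => g (act σ v) 0) ?_
    rw [map_sum, add_comm]
    congr 1
    refine Finset.sum_congr rfl fun k _ => ?_
    rw [pairing_toVec, map_smul]
    congr 1
    refine integral_congr_ae (.of_forall fun u => ?_)
    simp [R, concat, vecToFun]

/-! ### Approximate division -/

/-- The quotient `u / max v δ` is continuous on `ℝ²` and agrees with `u / v` for `v ≥ δ`. Half of
`ε` pays for the network, half for the perturbed inputs, by uniform continuity on a box enlarged by
one to contain them. -/
theorem exists_isLayered_div {σ : C(ℝ, ℝ)} (hσ' : ¬ ∃ a b : ℝ, ∀ t, σ t = a * t + b) {δ : ℝ}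
    (hδ : 0 < δ) (B : ℝ) {ε : ℝ} (hε : 0 < ε) :
    ∃ N : Vec 2 → Vec 1, IsLayered σ N ∧ ∃ η > 0, ∀ u v u' v', |u| ≤ B → |v| ≤ B → δ ≤ v →
      |u' - u| ≤ η → |v' - v| ≤ η → |N !₂[u', v'] 0 - u / v| ≤ ε := by
  have hmax : ∀ t : ℝ, max t δ ≠ 0 := fun t => (lt_max_of_lt_right hδ).ne'
  let F : C(Vec 2, ℝ) := ⟨fun z => z 0 / max (z 1) δ,
    Continuous.div (by fun_prop) (by fun_prop) fun z => hmax _⟩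
  let S : Set (ℝ × ℝ) := Set.Icc (-(B + 1)) (B + 1) ×ˢ Set.Icc (-(B + 1)) (B + 1)
  have hS : IsCompact S := isCompact_Icc.prod isCompact_Icc
  let j : ℝ × ℝ → Vec 2 := fun p => !₂[p.1, p.2]
  have hj : Continuous j := by
    refine (PiLp.continuous_toLp 2 _).comp (continuous_pi fun i => ?_)
    fin_cases i
    · exact continuous_fst
    · exact continuous_snd
  obtain ⟨N, hN, hNF⟩ := exists_isLayered_near hσ' F (hS.image hj) (half_pos hε)
  obtain ⟨η, hη, hF⟩ := Metric.uniformContinuousOn_iff.1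
    (hS.uniformContinuousOn_of_continuous (F.continuous.comp hj).continuousOn) (ε / 2) (half_pos hε)
  refine ⟨N, hN, min (η / 2) 1, by positivity, fun u v u' v' hu hv hδv hu' hv' => ?_⟩
  rw [abs_le] at hu hv
  have hu1 := abs_le.1 (hu'.trans (min_le_right _ _))
  have hv1 := abs_le.1 (hv'.trans (min_le_right _ _))
  have hp : (u, v) ∈ S := ⟨⟨by linarith, by linarith⟩, ⟨by linarith, by linarith⟩⟩
  have hp' : (u', v') ∈ S := ⟨⟨by linarith, by linarith⟩, ⟨by linarith, by linarith⟩⟩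
  have h1 := hF (u', v') hp' (u, v) hp (by
    rw [Prod.dist_eq, Real.dist_eq, Real.dist_eq]
    have := min_le_left (η / 2) 1
    exact max_lt (by linarith) (by linarith))
  have h2 := hNF (j (u', v')) ⟨_, hp', rfl⟩
  have hFuv : F (j (u, v)) = u / v := by
    simp [F, j, max_eq_left hδv]
  simp only [Function.comp_apply, hFuv, Real.dist_eq] at h1
  calc |N !₂[u', v'] 0 - u / v| ≤ |N !₂[u', v'] 0 - F (j (u', v'))| + |F (j (u', v')) - u / v| :=
        abs_sub_le _ _ _
    _ ≤ ε := by
        have h3 : |N !₂[u', v'] 0 - F (j (u', v'))| ≤ ε / 2 := h2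
        linarith

/-! ### Approximation of the conditioning operators -/

theorem exists_pos_forall_mul_rpow_le {α : ℝ} (hα : 0 < α) (R : ℝ) {c : ℝ} (hc : 0 < c) :
    ∃ τ > 0, ∀ d : ℝ, 0 ≤ d → d < τ → R * d ^ α ≤ c := by
  have h : Continuous fun d : ℝ => R * d ^ α :=
    continuous_const.mul (Real.continuous_rpow_const hα.le)
  have h0 : R * (0 : ℝ) ^ α < c := by simpa [Real.zero_rpow hα.ne'] using hc
  obtain ⟨τ, hτ, hball⟩ := Metric.eventually_nhds_iff.1 (h.continuousAt.eventually_lt_const h0)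
  exact ⟨τ, hτ, fun d hd hdτ => (hball (by rwa [Real.dist_eq, sub_zero, abs_of_nonneg hd])).le⟩

theorem abs_integral_sub_le {X : Type*} [MeasurableSpace X] {μ : Measure X} {f g K : X → ℝ}
    (hf : Integrable f μ) (hg : Integrable g μ) (hK : Integrable K μ) {ε : ℝ}
    (h : ∀ x, |f x - g x| ≤ ε * K x) : |∫ x, f x ∂μ - ∫ x, g x ∂μ| ≤ ε * ∫ x, K x ∂μ := by
  rw [← integral_sub hf hg, ← integral_const_mul, ← Real.norm_eq_abs]
  exact norm_integral_le_of_norm_le (hK.const_mul ε) (.of_forall h)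

/-- Finite rank turns integration against the kernel into the sum computed by a hidden layer. -/
theorem sum_integral_mul_enc_mul_out {p k : ℕ} {Ω : Compacts (Vec p)} {B : Compacts (Vec k)} {η : ℝ}
    (κ : AveragingKernel B η) {f : Ω → ℝ} (hf : Continuous f) {q : Ω → Vec k} (hq : Continuous q)
    (y : Vec k) : ∑ l, (∫ u, f u * κ.enc l (q u) ∂(leb Ω)) * κ.out l y =
      ∫ u, f u * κ.val y (q u) ∂(leb Ω) := by
  have hi : ∀ l, Integrable (fun u => f u * κ.enc l (q u) * κ.out l y) (leb Ω) := fun l =>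
    integrable_leb (by fun_prop)
  simp_rw [← integral_mul_const]
  rw [← integral_finsetSum _ fun l _ => hi l]
  refine integral_congr_ae (.of_forall fun u => ?_)
  simp only [AveragingKernel.val, Finset.mul_sum]
  exact Finset.sum_congr rfl fun l _ => by ring

section

variable {m r : ℕ} {D : Compacts (Vec m)} {E : Compacts (Vec r)}

theorem exists_neuralOperator_near_kernelOp (hE : (leb E).IsOpenPosMeasure) {σ : C(ℝ, ℝ)}
    (hσ' : ¬ ∃ a b : ℝ, ∀ t, σ t = a * t + b) {α R δ : ℝ} (hα : 0 < α) (hR : 0 < R) (hδ : 0 < δ)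
    {ε : ℝ} (hε : 0 < ε) :
    ∃ Ψ : C(prodDom D E, ℝ) → C(prodDom D E, ℝ), IsScalarNeuralOperator σ 1 Ψ ∧
      ∀ ρ : densitiesGE D E δ, ρ.1 ∈ holderBall (prodDom D E) α R →
        ‖kernelOp hδ ρ - Ψ ρ.1‖ ≤ ε := by
  let V := (leb D).real Set.univ
  have hV : 0 ≤ V := measureReal_nonneg
  obtain ⟨N, hN, η, hη, hdiv⟩ := exists_isLayered_div hσ' hδ (R * (1 + V)) hε
  -- An oscillation of `ρ` costs the marginal a factor `V`, the volume of `D`; `1 + V` avoids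
  -- dividing by zero.
  have hc : 0 < η / (1 + V) := by positivity
  have hcV : η / (1 + V) * V ≤ η := by
    rw [div_mul_eq_mul_div, div_le_iff₀ (by positivity)]
    nlinarith
  obtain ⟨τ, hτ, hmod⟩ := exists_pos_forall_mul_rpow_le hα R hc
  obtain ⟨κ⟩ := exists_averagingKernel E hE hτ
  let lift : C(Vec r, ℝ) → C(prodDom D E, ℝ) := fun f =>
    ⟨fun z => f (sndPt z), f.continuous.comp (continuous_subtype_val.comp continuous_sndPt)⟩
  obtain ⟨Ψ, hΨ, hΨN⟩ := exists_isScalarNeuralOperator σ.continuous hN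
    (fun k => lift (κ.enc k)) (fun k => lift (κ.out k))
  refine ⟨Ψ, hΨ, fun ρ hρ => (ContinuousMap.norm_le _ hε.le).2 fun z => ?_⟩
  obtain ⟨hρR, hρα⟩ := (mem_holderBall_iff hα hR.le).1 hρ
  have hsum : ∑ k, (∫ u, ρ.1 u * lift (κ.enc k) u ∂(leb (prodDom D E))) * lift (κ.out k) z =
      ∫ u, ρ.1 u * κ.val (sndPt z) (sndPt u) ∂(leb (prodDom D E)) :=
    sum_integral_mul_enc_mul_out κ ρ.1.continuous
      (continuous_subtype_val.comp continuous_sndPt) _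
  rw [← norm_neg, ContinuousMap.coe_sub, Pi.sub_apply, neg_sub, Real.norm_eq_abs, hΨN, hsum]
  -- The numerator is the exact value `ρ z`, passed by the local term; only the marginal carries an
  -- error.
  refine hdiv _ _ _ _ ((hρR z).trans (by nlinarith)) ((abs_marginal_le hρR _).trans ?_)
    (ρ.2.2 _) (by simpa using hη.le) ?_
  · nlinarith
  · refine (abs_integral_mul_averagingKernel_sub_marginal_le κ (sndPt z) fun x y' hy' => ?_).trans
      hcV
    refine (hρα _ _).trans (hmod _ dist_nonneg ((dist_mkPt_le _ _ _ _).trans_lt ?_))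
    rwa [dist_self, zero_add, dist_comm]

/-- A network for the lifted function `(z', ρ(z')) ↦ ρ(z') κ(y, y')`. -/
theorem exists_isLayered_mul_averagingKernel {σ : C(ℝ, ℝ)}
    (hσ' : ¬ ∃ a b : ℝ, ∀ t, σ t = a * t + b) (R : ℝ) {η : ℝ} (κ : AveragingKernel E η) {ε : ℝ}
    (hε : 0 < ε) :
    ∃ N : Vec (m + r + (1 + r)) → Vec 1, IsLayered σ N ∧
      ∀ (f : C(prodDom D E, ℝ)) (z : prodDom D E) (y : E), |f z| ≤ R →
        |N (vappend z (vappend (toVec f z) y)) 0 - f z * κ.val y (sndPt z)| ≤ ε := by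
  let F : C(Vec (m + r + (1 + r)), ℝ) :=
    ⟨fun w => vfirst (vlast w) 0 * κ.val (vlast (vlast w)) (vlast (vfirst w)), by
      refine Continuous.mul ?_ ?_
      · have := (continuous_vfirst (a := 1) (b := r)).comp (continuous_vlast (a := m + r))
        exact (PiLp.continuous_apply 2 _ 0).comp this
      · exact κ.continuous_val.comp ((continuous_vlast.comp continuous_vlast).prodMk
          (continuous_vlast.comp continuous_vfirst))⟩
  let j : prodDom D E × ℝ × E → Vec (m + r + (1 + r)) := fun q =>
    vappend q.1 (vappend (WithLp.toLp 2 fun _ : Fin 1 => q.2.1) q.2.2)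
  have hj : Continuous j := by
    refine continuous_vappend.comp ((by fun_prop : Continuous fun q : prodDom D E × ℝ × E =>
      (q.1 : Vec (m + r))).prodMk (continuous_vappend.comp (Continuous.prodMk ?_ ?_))) <;> fun_prop
  obtain ⟨N, hN, hNF⟩ := exists_isLayered_near hσ' F
    ((isCompact_univ.prod ((isCompact_Icc (a := -R) (b := R)).prod isCompact_univ)).image hj) hε
  refine ⟨N, hN, fun f z y hf => ?_⟩
  have h := hNF (j (z, f z, y)) ⟨_, ⟨Set.mem_univ _, abs_le.1 hf, Set.mem_univ _⟩, rfl⟩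
  have hF : F (j (z, f z, y)) = f z * κ.val y (sndPt z) := by
    simp only [F, j, ContinuousMap.coe_mk, vlast_vappend, vfirst_vappend]
    rfl
  rwa [hF] at h

theorem exists_augNeuralOperator_near_incontextOp (hD : (leb D).IsOpenPosMeasure)
    (hE : (leb E).IsOpenPosMeasure) {σ : C(ℝ, ℝ)}
    (hσ' : ¬ ∃ a b : ℝ, ∀ t, σ t = a * t + b) {α R δ : ℝ} (hα : 0 < α) (hR : 0 < R) (hδ : 0 < δ)
    {ε : ℝ} (hε : 0 < ε) :
    ∃ Ψt : C(prodDom D E, ℝ) × E → C(D, ℝ), IsScalarAugNeuralOperator σ 1 Ψt ∧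
      ∀ (ρ : densitiesGE D E δ) (y : E), ρ.1 ∈ holderBall (prodDom D E) α R →
        ‖incontextOp (ρ, y) - Ψt (ρ.1, y)‖ ≤ ε := by
  let V := (leb D).real Set.univ
  let V' := (leb E).real Set.univ
  let V'' := (leb (prodDom D E)).real Set.univ
  have hV : 0 ≤ V := measureReal_nonneg
  have hV' : 0 ≤ V' := measureReal_nonneg
  have hV'' : 0 ≤ V'' := measureReal_nonneg
  obtain ⟨N₂, hN₂, η, hη, hdiv⟩ := exists_isLayered_div hσ' hδ (R * (1 + V)) hε
  have hc : 0 < η / 2 / (1 + V) := by positivity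
  have hcV : η / 2 / (1 + V) * V ≤ η / 2 := by
    rw [div_mul_eq_mul_div, div_le_iff₀ (by positivity)]
    nlinarith
  have hc1 : η / 2 / (1 + V) ≤ η / 2 := div_le_self (by positivity) (by linarith)
  obtain ⟨τ, hτ, hmod⟩ := exists_pos_forall_mul_rpow_le hα R hc
  -- Scale `τ / 2` in each factor keeps the distance in `D × E` below `τ`.
  obtain ⟨κ⟩ := exists_averagingKernel D hD (half_pos hτ)
  obtain ⟨κ'⟩ := exists_averagingKernel E hE (half_pos hτ)
  -- The error of `N₁` is multiplied by `V'` when integrated against `κ(x, x')` over `D × E`, and by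
  -- `V''` when integrated against `1`.
  let ε₁ := η / 2 / (1 + V' + V'')
  have hε₁ : 0 < ε₁ := by positivity
  have hε₁V' : ε₁ * V' ≤ η / 2 := by
    simp only [ε₁]
    rw [div_mul_eq_mul_div, div_le_iff₀ (by positivity)]
    nlinarith
  have hε₁V'' : ε₁ * V'' ≤ η / 2 := by
    simp only [ε₁]
    rw [div_mul_eq_mul_div, div_le_iff₀ (by positivity)]
    nlinarith
  obtain ⟨N₁, hN₁, hN₁κ⟩ := exists_isLayered_mul_averagingKernel (D := D) hσ' R κ' hε₁
  have hN₁c := hN₁.isNeuralNetwork.continuous σ.continuous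
  let lift : C(Vec m, ℝ) → C(prodDom D E, ℝ) := fun f =>
    ⟨fun z => f (fstPt z), f.continuous.comp continuous_fstPt⟩
  -- The terms of `κ` feed the first coordinate, the numerator; one extra term with encoding
  -- function `1` feeds the second, the marginal.
  obtain ⟨Ψt, hΨt, hΨN⟩ := exists_isScalarAugNeuralOperator (Ω := prodDom D E) (Ω' := D) (Z := E)
    σ.continuous hN₁.isNeuralNetwork hN₂
    (Fin.snoc (α := fun _ => C(prodDom D E, ℝ)) (fun k => lift (κ.enc k)) 1)
    (Fin.snoc (α := fun _ => C(D, Vec 2))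
      (fun k => ⟨fun x => κ.out k x • !₂[1, 0], by fun_prop⟩) (ContinuousMap.const _ !₂[0, 1]))
  refine ⟨Ψt, hΨt, fun ρ y hρ => (ContinuousMap.norm_le _ hε.le).2 fun x => ?_⟩
  obtain ⟨hρR, hρα⟩ := (mem_holderBall_iff hα hR.le).1 hρ
  let u : prodDom D E → ℝ := fun z => N₁ (vappend z (vappend (toVec ρ.1 z) y)) 0
  have hu : Continuous u := (PiLp.continuous_apply 2 _ 0).comp (hN₁c.comp (continuous_vappend.comp
    (continuous_subtype_val.prodMk (continuous_vappend.comp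
      ((toVec ρ.1).continuous.prodMk continuous_const)))))
  have hκ : Continuous fun z : prodDom D E => κ.val x (fstPt z) :=
    κ.continuous_val.comp (continuous_const.prodMk continuous_fstPt)
  have hκ' : Continuous fun z : prodDom D E => κ'.val y (sndPt z) :=
    κ'.continuous_val.comp (continuous_const.prodMk (continuous_subtype_val.comp continuous_sndPt))
  have huρ : ∀ z, |u z - ρ.1 z * κ'.val y (sndPt z)| ≤ ε₁ := fun z => hN₁κ ρ.1 z y (hρR z)
  have hfeat : (∑ k, (∫ z : prodDom D E, N₁ (vappend z (vappend (toVec ρ.1 z) y)) 0 *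
      (Fin.snoc (α := fun _ => C(prodDom D E, ℝ)) (fun k => lift (κ.enc k)) 1 :
        Fin (κ.rank + 1) → C(prodDom D E, ℝ)) k z ∂(leb (prodDom D E))) •
      (Fin.snoc (α := fun _ => C(D, Vec 2)) (fun k => ⟨fun x => κ.out k x • !₂[1, 0], by fun_prop⟩)
        (ContinuousMap.const _ !₂[0, 1]) : Fin (κ.rank + 1) → C(D, Vec 2)) k x) =
      !₂[∫ z, u z * κ.val x (fstPt z) ∂(leb (prodDom D E)), ∫ z, u z ∂(leb (prodDom D E))] := by
    have hsum : ∑ k, (∫ z, u z * lift (κ.enc k) z ∂(leb (prodDom D E))) * κ.out k x =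
        ∫ z, u z * κ.val x (fstPt z) ∂(leb (prodDom D E)) :=
      sum_integral_mul_enc_mul_out κ hu continuous_fstPt _
    rw [Fin.sum_univ_castSucc]
    simp only [Fin.snoc_castSucc, Fin.snoc_last, ContinuousMap.coe_mk, ContinuousMap.const_apply,
      ContinuousMap.one_apply, mul_one, smul_smul]
    rw [← Finset.sum_smul]
    change (∑ k, (∫ z, u z * lift (κ.enc k) z ∂(leb (prodDom D E))) * κ.out k x) • !₂[1, 0] +
      (∫ z, u z ∂(leb (prodDom D E))) • !₂[(0 : ℝ), 1] = _
    rw [hsum]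
    ext i
    fin_cases i <;> simp
  have hclose : ∀ x' y', dist (mkPt x' y') (mkPt x y) < τ →
      |ρ.1 (mkPt x' y') - ρ.1 (mkPt x y)| ≤ η / 2 / (1 + V) := fun x' y' h =>
    (hρα _ _).trans (hmod _ dist_nonneg h)
  rw [← norm_neg, ContinuousMap.coe_sub, Pi.sub_apply, neg_sub, Real.norm_eq_abs, hΨN, hfeat]
  refine hdiv _ _ _ _ ((hρR _).trans (by nlinarith)) ((abs_marginal_le hρR _).trans (by nlinarith))
    (ρ.2.2 _) ?_ ?_
  · have h1 := abs_integral_mul_averagingKernels_sub_le (ρ := ρ.1) κ κ' x y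
      fun x' y' hx' hy' => hclose x' y' ((dist_mkPt_le _ _ _ _).trans_lt (by
        rw [dist_comm x', dist_comm y']
        linarith))
    have h2 := abs_integral_sub_le (ε := ε₁) (integrable_leb (hu.mul hκ))
      (integrable_leb (ρ.1.continuous.mul (hκ.mul hκ'))) (integrable_leb hκ) fun z => by
        have e : u z * κ.val x (fstPt z) -
            ρ.1 z * (κ.val x (fstPt z) * κ'.val y (sndPt z)) =
              (u z - ρ.1 z * κ'.val y (sndPt z)) * κ.val x (fstPt z) := by ring
        change |u z * κ.val x (fstPt z) -
            ρ.1 z * (κ.val x (fstPt z) * κ'.val y (sndPt z))| ≤ _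
        rw [e, abs_mul, abs_of_nonneg (show 0 ≤ κ.val x (fstPt z) from κ.nonneg _ _)]
        exact mul_le_mul_of_nonneg_right (huρ z) (κ.nonneg _ _)
    rw [integral_averagingKernel_fst] at h2
    refine (abs_sub_le _ _ _).trans ((add_le_add h2 h1).trans ?_)
    linarith
  · have h1 := abs_integral_mul_averagingKernel_sub_marginal_le (ρ := ρ.1) κ' y
      fun x' y' hy' => by
        refine (hρα _ _).trans (hmod _ dist_nonneg ((dist_mkPt_le _ _ _ _).trans_lt ?_))
        rw [dist_self, zero_add, dist_comm]
        linarith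
    have h2 := abs_integral_sub_le (ε := ε₁) (integrable_leb hu)
      (integrable_leb (ρ.1.continuous.mul hκ'))
      (integrable_const (μ := leb (prodDom D E)) (1 : ℝ)) fun z => by
        rw [mul_one]
        exact huρ z
    rw [integral_const, smul_eq_mul, mul_one] at h2
    refine (abs_sub_le _ _ _).trans ((add_le_add h2 h1).trans ?_)
    linarith

end

end CondNO

theorem mainTheorem10 {m r : ℕ}
    (D : TopologicalSpace.Compacts (CondNO.Vec m)) (E : TopologicalSpace.Compacts (CondNO.Vec r))
    (hD : CondNO.HasLipschitzBoundary (D : Set (CondNO.Vec m)))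
    (hE : CondNO.HasLipschitzBoundary (E : Set (CondNO.Vec r)))
    (σ : ℝ → ℝ) (hσ : Continuous σ) (hσ' : ¬ ∃ a b : ℝ, ∀ t, σ t = a * t + b)
    (α R δ : ℝ) (hα : 0 < α) (hα' : α ≤ 1) (hR : 0 < R) (hδ : 0 < δ) :
    IsCompact (CondNO.densitiesGE D E δ ∩ CondNO.holderBall (CondNO.prodDom D E) α R) ∧
    ∀ ε : ℝ, 0 < ε →
      (∃ (L : ℕ) (Ψ : C(CondNO.prodDom D E, ℝ) → C(CondNO.prodDom D E, ℝ)),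
        CondNO.IsScalarNeuralOperator σ L Ψ ∧
        ∀ ρ : CondNO.densitiesGE D E δ, ρ.1 ∈ CondNO.holderBall (CondNO.prodDom D E) α R →
          ‖CondNO.kernelOp hδ ρ - Ψ ρ.1‖ ≤ ε) ∧
      (∃ (L : ℕ) (Ψt : C(CondNO.prodDom D E, ℝ) × E → C(D, ℝ)),
        CondNO.IsScalarAugNeuralOperator σ L Ψt ∧
        ∀ (ρ : CondNO.densitiesGE D E δ) (y : E),
          ρ.1 ∈ CondNO.holderBall (CondNO.prodDom D E) α R →
          ‖CondNO.incontextOp (ρ, y) - Ψt (ρ.1, y)‖ ≤ ε) := by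
  have hDpos := hD.isOpenPosMeasure
  have hEpos := hE.isOpenPosMeasure
  -- One hidden layer suffices for both operators, as the lifting and projection networks may be
  -- arbitrarily deep.
  refine ⟨(CondNO.isCompact_holderBall _ hα hR.le).inter_left (CondNO.isClosed_densitiesGE δ),
    fun ε hε => ⟨⟨1, ?_⟩, ⟨1, ?_⟩⟩⟩
  · exact CondNO.exists_neuralOperator_near_kernelOp (σ := ⟨σ, hσ⟩) hEpos hσ' hα hR hδ hε
  · exact CondNO.exists_augNeuralOperator_near_incontextOp (σ := ⟨σ, hσ⟩) hDpos hEpos hσ' hα hR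
      hδ hε
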